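/- For $\lambda>-1$ let $H_\lambda=L_2([-1/2,1/2],|t|^\lambda\,dt;\mathbb{C})$ and, for $n\in\mathbb{Z}$, let $\tau_n(t)=e^{2\pi i n t}$. For $0<p<\infty$ and $0<s\le\infty$ let $\ell_{p,s}$ be the Lorentz space of all complex sequences $a=(a_n)_{n\in\mathbb{Z}}$ whose absolute values have a non-increasing rearrangement $(a_n^*)_{n=1}^\infty$ with \[ \|a\|_{p,s}=\Bigl(\sum_{n=1}^\infty (n^{1/p}a_n^*)^s\,\frac1n\Bigr)^{1/s}<\infty \qquad\Bigl(\|a\|_{p,\infty}=\sup_{n\ge1} n^{1/p}a_n^*<\infty \text{ if } s=\infty\Bigr). \] Let $0<\alpha<1$, $0<p<\infty$, $0<s\le\infty$, and put $r_\alpha=\frac{2}{1-\alpha}$, $q_\alpha=\frac{2}{1+\alpha}$. (i) The Fourier coefficient transform $f\mapsto\bigl(\int_{-1/2}^{1/2}f(t)e^{-2\pi i n t}\,dt\bigr)_{n\in\mathbb{Z}}$ is a bounded operator from $H_\alpha$ into $\ell_{p,s}$ if and only if $p>r_\alpha$, or $p=r_\alpha$ and $s\ge2$. (ii) The Fourier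 series transform $(a_n)_{n\in\mathbb{Z}}\mapsto\sum_{n\in\mathbb{Z}}a_n\tau_n$, where the series is required to converge in the norm of $H_{-\alpha}$ in the order $n=0,1,-1,2,-2,\dots$, is a bounded operator from $\ell_{p,s}$ into $H_{-\alpha}$ if and only if $p<q_\alpha$, or $p=q_\alpha$ and $s\le2$. In particular, at the critical first indices $p=r_\alpha$ and $p=q_\alpha$, boundedness holds exactly for $s\ge2$ and $s\le2$, respectively. -/

import Mathlib

open MeasureTheory Filter Topology
open scoped ENNReal NNReal

noncomputable section

namespace PowerFourier

/-- The power weight `w_lam(t) = |t| ^ lam`, with values in `[0, ∞]`. -/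
def weight (lam : ℝ) (t : ℝ) : ℝ≥0∞ := ENNReal.ofReal |t| ^ lam

/-- The measure `|t| ^ lam dt` on the interval `[-1/2, 1/2]`. -/
def weightMeasure (lam : ℝ) : Measure ℝ :=
  (volume.restrict (Set.Icc (-1 / 2 : ℝ) (1 / 2))).withDensity (weight lam)

/-- The complex Hilbert space `H_lam = L₂([-1/2, 1/2], |t| ^ lam dt; ℂ)`. -/
abbrev H (lam : ℝ) : Type := Lp ℂ 2 (weightMeasure lam)

/-- The trigonometric function `τ_n(t) = e ^ (2 π i n t)`. -/
def tau (n : ℤ) (t : ℝ) : ℂ := Complex.exp (2 * Real.pi * Complex.I * n * t)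

theorem isFiniteMeasure_weightMeasure {lam : ℝ} (hlam : -1 < lam) :
    IsFiniteMeasure (weightMeasure lam) := by
  have hint : IntervalIntegrable (fun t : ℝ => |t| ^ lam) volume (-1 / 2) (1 / 2) := by
    have h0 : IntervalIntegrable (fun t : ℝ => |t| ^ lam) volume 0 (1 / 2) := by
      refine (intervalIntegral.intervalIntegrable_rpow' (a := 0) (b := 1 / 2) hlam).congr ?_
      intro t ht
      rw [Set.uIoc_of_le (by norm_num)] at ht
      simp [abs_of_pos ht.1]
    have h1 : IntervalIntegrable (fun t : ℝ => |t| ^ lam) volume (-1 / 2) 0 := by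
      have h2 := h0.comp_sub_left 0
      simp only [zero_sub, abs_neg, neg_zero] at h2
      have h3 := h2.symm
      rwa [← neg_div] at h3
    exact h1.trans h0
  rw [intervalIntegrable_iff_integrableOn_Icc_of_le (by norm_num)] at hint
  refine isFiniteMeasure_withDensity ?_
  have hae : ∀ᵐ t ∂(volume.restrict (Set.Icc (-1 / 2 : ℝ) (1 / 2))),
      weight lam t = ENNReal.ofReal (|t| ^ lam) := by
    have hne : ∀ᵐ t ∂(volume : Measure ℝ), t ≠ 0 := by
      simp [ae_iff]
    filter_upwards [ae_restrict_of_ae hne] with t ht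
    exact ENNReal.ofReal_rpow_of_pos (abs_pos.mpr ht)
  rw [lintegral_congr_ae hae]
  exact hint.lintegral_lt_top.ne

theorem memLp_tau {lam : ℝ} (hlam : -1 < lam) (n : ℤ) :
    MemLp (tau n) 2 (weightMeasure lam) := by
  have := isFiniteMeasure_weightMeasure hlam
  have hc : Continuous (tau n) := by unfold tau; fun_prop
  refine MemLp.of_bound hc.aestronglyMeasurable 1 (Eventually.of_forall fun t => ?_)
  have h : (2 * Real.pi * Complex.I * n * t : ℂ)
      = ((2 * Real.pi * n * t : ℝ) : ℂ) * Complex.I := by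
    push_cast; ring
  rw [tau, h, Complex.norm_exp_ofReal_mul_I]

/-- `τ_n` as an element of `H_lam`. -/
def tauH {lam : ℝ} (hlam : -1 < lam) (n : ℤ) : H lam := (memLp_tau hlam n).toLp (tau n)

/-- The natural arrangement `0, 1, -1, 2, -2, …` of `ℤ`: `2k ↦ -k` and `2k + 1 ↦ k + 1`. -/
def natArr (k : ℕ) : ℤ := if Even k then -((k / 2 : ℕ) : ℤ) else ((k / 2 : ℕ) : ℤ) + 1

/-- The non-increasing rearrangement of the family `(|a k|)`; its entry number `n` (counted
from `0`) is the infimum of all `t ∈ [0, ∞]` such that at most `n` indices `k` have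
`|a k| > t`. It is `∞` exactly when `a` is unbounded. -/
def rearr {ι : Type*} (a : ι → ℂ) (n : ℕ) : ℝ≥0∞ :=
  sInf {t : ℝ≥0∞ | {k : ι | t < ‖a k‖ₑ}.encard ≤ n}

/-- The quasi-norm of the Lorentz sequence space `ℓ_{p,s}`, with values in `[0, ∞]`: if
`a₁* ≥ a₂* ≥ …` is the non-increasing rearrangement of `a`, then it is
`(∑ (n ^ (1/p) * aₙ*) ^ s / n) ^ (1/s)` for `s < ∞` and `sup n ^ (1/p) * aₙ*` for `s = ∞`.
The entry `aₙ*` is `rearr a (n - 1)`. -/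
def lorentzNorm {ι : Type*} (p : ℝ) (s : ℝ≥0∞) (a : ι → ℂ) : ℝ≥0∞ :=
  if s = ∞ then ⨆ n : ℕ, ((n : ℝ≥0∞) + 1) ^ (1 / p) * rearr a n
  else (∑' n : ℕ, (((n : ℝ≥0∞) + 1) ^ (1 / p) * rearr a n) ^ s.toReal / ((n : ℝ≥0∞) + 1))
    ^ (1 / s.toReal)

/-- Membership in `ℓ_{p,s}`. -/
def MemLorentz {ι : Type*} (p : ℝ) (s : ℝ≥0∞) (a : ι → ℂ) : Prop := lorentzNorm p s a < ∞

/-- The Fourier coefficients `∫_{-1/2}^{1/2} f(t) e ^ (-2 π i n t) dt` of a function `f`,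
with respect to Lebesgue measure. -/
def fourierCoeffs (f : ℝ → ℂ) (n : ℤ) : ℂ :=
  ∫ t in Set.Icc (-1 / 2 : ℝ) (1 / 2), f t * Complex.exp (-(2 * Real.pi * Complex.I * n * t))

/-- The Fourier coefficient transform is a bounded operator from `H_lam` into `ℓ_{p,s}`:
it is defined on `H_lam` (that is, functions in `H_lam` are Lebesgue integrable), maps it into
`ℓ_{p,s}`, and satisfies a norm estimate. -/
def CoeffTransformBounded (lam p : ℝ) (s : ℝ≥0∞) : Prop :=
  (∀ f : H lam, IntegrableOn (f : ℝ → ℂ) (Set.Icc (-1 / 2 : ℝ) (1 / 2)) volume) ∧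
  (∀ f : H lam, MemLorentz p s (fourierCoeffs f)) ∧
  ∃ C : ℝ≥0, ∀ f : H lam, lorentzNorm p s (fourierCoeffs f) ≤ C * ‖f‖ₑ

/-- The Fourier series transform is a bounded operator from `ℓ_{p,s}` into `H_lam`: for every
`a ∈ ℓ_{p,s}` the series `∑ a_n τ_n`, in the natural arrangement of the trigonometric system,
converges in the norm of `H_lam`, and its sum satisfies a norm estimate. -/
def SeriesTransformBounded {lam : ℝ} (hlam : -1 < lam) (p : ℝ) (s : ℝ≥0∞) : Prop :=
  ∃ C : ℝ≥0, ∀ a : ℤ → ℂ, MemLorentz p s a →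
    ∃ g : H lam,
      Tendsto (fun N : ℕ => ∑ k ∈ Finset.range N, a (natArr k) • tauH hlam (natArr k))
        atTop (𝓝 g) ∧
      ‖g‖ₑ ≤ C * lorentzNorm p s a

end PowerFourier

end

/-! The norm of `∑ a_n τ_n` in `H (-α)` is a quadratic form in `a` whose matrix entries are Fourier
coefficients of `|t|^(-α)`. These are `O((1 + |n - m|)^(α-1))`, so after absolute values are taken,
sufficiency in (ii) at `q = 2/(1+α)`, `s = 2` is a discrete Hardy-Littlewood-Sobolev inequality on
`ℓ_{q,2}` (`tsum_tsum_decayKernel_le`). It is proved by cutting `a` into dyadic blocks along its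
rearrangement: the interaction of two blocks decays geometrically in the distance of their indices,
so Schur-type summation leaves a sum of squares over blocks, and Cauchy condensation identifies that
sum with the `ℓ_{q,2}` norm.

Sufficiency in (i) at `r = 2/(1-α)`, `s = 2` is dual. The coefficients of `f ∈ H α` are paired with
a sequence built from their own dyadic blocks; the same inequality bounds the pairing, and the sum
being estimated appears on both sides and cancels. All other admissible `(p, s)` follow from the
embeddings between Lorentz spaces (`lorentzNorm_embedding`).

For necessity, one tent function per dyadic scale, normalised in `H α` and summed over about `N`
scales, gives `f` with `‖f‖² ≲ N` (tents of different scales are almost orthogonal) and coefficients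
`≳ n^(-1/r)` for `n ≤ 2^N` (`exists_testFunction`). Hence the `ℓ_{r,s}` norm of the coefficients is
`≳ N^(1/s)`, against `‖f‖ ≲ N^(1/2)`; this excludes `s < 2` in (i). Pairing the same `f` with the
sequence `n^(-1/q)`, `n ≤ 2^N`, of norm `≲ N^(1/s)`, gives a harmonic sum `≳ N`; so boundedness in
(ii) would force `N ≲ N^(1/2 + 1/s)`, which excludes `2 < s < ∞`. The embeddings again settle the
remaining cases. -/

namespace PowerFourier

/-! ### Rearrangements and embeddings of Lorentz sequence spaces -/

section Lorentz

variable {ι : Type*}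

theorem rearr_antitone (a : ι → ℂ) : Antitone (rearr a) := by
  intro m n hmn
  refine sInf_le_sInf fun t ht => ?_
  exact le_trans (show _ ≤ (m : ℕ∞) from ht) (by exact_mod_cast hmn)

/-- The infimum defining `rearr` is attained: among `n + 1` offending indices the smallest modulus
still exceeds the infimum, so some admissible level lies below all of them. -/
theorem encard_rearr_lt_le (a : ι → ℂ) (n : ℕ) :
    {k : ι | rearr a n < ‖a k‖ₑ}.encard ≤ n := by
  by_contra! h
  obtain ⟨t, hts, ht⟩ := Set.exists_subset_encard_eq (Order.add_one_le_of_lt h)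
  have hfin : t.Finite := by
    refine Set.finite_of_encard_eq_coe (k := n + 1) ?_
    rw [ht]; norm_cast
  have hne : t.Nonempty := by
    rw [← Set.encard_pos, ht]; positivity
  obtain ⟨k₀, hk₀, hmin⟩ := Set.exists_min_image t (fun k => ‖a k‖ₑ) hfin hne
  obtain ⟨u, hu, huk⟩ := sInf_lt_iff.1 (show rearr a n < ‖a k₀‖ₑ from hts hk₀)
  have h1 : t.encard ≤ n :=
    le_trans (Set.encard_le_encard fun k hk => lt_of_lt_of_le huk (hmin k hk)) hu
  rw [ht] at h1
  have h2 : n + 1 ≤ n := by exact_mod_cast h1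
  omega

theorem lt_encard_of_lt_rearr {a : ι → ℂ} {n : ℕ} {t : ℝ≥0∞} (h : t < rearr a n) :
    (n : ℕ∞) < {k : ι | t < ‖a k‖ₑ}.encard := by
  by_contra! h'
  exact absurd (sInf_le (show t ∈ {t : ℝ≥0∞ | {k : ι | t < ‖a k‖ₑ}.encard ≤ n} from h')) h.not_ge

theorem rearr_le_of_encard_le {a : ι → ℂ} {n : ℕ} {t : ℝ≥0∞}
    (h : {k : ι | t < ‖a k‖ₑ}.encard ≤ n) : rearr a n ≤ t :=
  sInf_le h

theorem le_rearr_of_forall_mem {a : ι → ℂ} {n : ℕ} {t : ℝ≥0∞} (E : Finset ι) (hE : n < E.card)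
    (h : ∀ k ∈ E, t ≤ ‖a k‖ₑ) : t ≤ rearr a n := by
  refine le_sInf fun u hu => ?_
  by_contra! hut
  have h1 : (E : Set ι).encard ≤ n :=
    le_trans (Set.encard_le_encard fun k hk => lt_of_lt_of_le hut (h k hk)) hu
  rw [Set.encard_coe_eq_coe_finsetCard] at h1
  have h2 : E.card ≤ n := by exact_mod_cast h1
  omega

theorem enorm_le_rearr_zero (a : ι → ℂ) (k : ι) : ‖a k‖ₑ ≤ rearr a 0 :=
  le_rearr_of_forall_mem {k} (by simp) (by simp)

theorem natCast_add_one_ne_zero (n : ℕ) : (n : ℝ≥0∞) + 1 ≠ 0 := by simp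

theorem natCast_add_one_ne_top (n : ℕ) : (n : ℝ≥0∞) + 1 ≠ ∞ := by simp

theorem lorentzNorm_top (p : ℝ) (a : ι → ℂ) :
    lorentzNorm p ∞ a = ⨆ n : ℕ, ((n : ℝ≥0∞) + 1) ^ (1 / p) * rearr a n := by
  simp [lorentzNorm]

theorem lorentzNorm_rpow {p : ℝ} {s : ℝ≥0∞} (hs : 0 < s) (hs' : s ≠ ∞) (a : ι → ℂ) :
    lorentzNorm p s a ^ s.toReal =
      ∑' n : ℕ, (((n : ℝ≥0∞) + 1) ^ (1 / p) * rearr a n) ^ s.toReal / ((n : ℝ≥0∞) + 1) := by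
  have h : s.toReal ≠ 0 := (ENNReal.toReal_pos hs.ne' hs').ne'
  rw [lorentzNorm, if_neg hs', ← ENNReal.rpow_mul, one_div_mul_cancel h, ENNReal.rpow_one]

/-- `ℓ_{p,s}` is continuously embedded in `ℓ_{p,∞}`. -/
theorem lorentzNorm_top_le {p : ℝ} {s : ℝ≥0∞} (hp : 0 < p) (hs : 0 < s) :
    ∃ C : ℝ≥0, ∀ a : ι → ℂ, lorentzNorm p ∞ a ≤ C * lorentzNorm p s a := by
  rcases eq_or_ne s ∞ with rfl | hs'
  · exact ⟨1, fun a => by simp⟩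
  set σ := s.toReal with hσ
  have hσ0 : 0 < σ := ENNReal.toReal_pos hs.ne' hs'
  refine ⟨(2 : ℝ≥0) ^ (1 / p + 1 / σ), fun a => ?_⟩
  rw [lorentzNorm_top]
  refine iSup_le fun n => ?_
  set x : ℝ≥0∞ := (n : ℝ≥0∞) + 1 with hx
  have hx0 : x ≠ 0 := natCast_add_one_ne_zero n
  have hxt : x ≠ ∞ := natCast_add_one_ne_top n
  have hpow : (x / 2 * (((x / 2) ^ (1 / p) * rearr a n) ^ σ / x)) ≤ lorentzNorm p s a ^ σ := by
    rw [lorentzNorm_rpow hs hs']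
    -- Only the block `n/2 ≤ m ≤ n` is kept. It has at least `x/2` members, the rearrangement there
    -- is at least `rearr a n`, and `m + 1` lies between `x/2` and `x`; the two halvings account for
    -- the constant `2^(1/p + 1/σ)`.
    refine le_trans ?_ (ENNReal.sum_le_tsum (Finset.Icc (n / 2) n))
    have hcard : x / 2 ≤ ((Finset.Icc (n / 2) n).card : ℝ≥0∞) := by
      rw [Nat.card_Icc]
      refine ENNReal.div_le_of_le_mul ?_
      rw [hx]
      have : n + 1 ≤ (n + 1 - n / 2) * 2 := by omega
      exact_mod_cast this
    calc x / 2 * (((x / 2) ^ (1 / p) * rearr a n) ^ σ / x)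
        ≤ ((Finset.Icc (n / 2) n).card : ℝ≥0∞) * (((x / 2) ^ (1 / p) * rearr a n) ^ σ / x) := by
          gcongr
      _ = ∑ _m ∈ Finset.Icc (n / 2) n, ((x / 2) ^ (1 / p) * rearr a n) ^ σ / x := by
          rw [Finset.sum_const, nsmul_eq_mul]
      _ ≤ _ := by
          refine Finset.sum_le_sum fun m hm => ?_
          rw [Finset.mem_Icc] at hm
          have h1 : x / 2 ≤ (m : ℝ≥0∞) + 1 := by
            refine ENNReal.div_le_of_le_mul ?_
            rw [hx]
            have : n + 1 ≤ (m + 1) * 2 := by omega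
            exact_mod_cast this
          have h2 : (m : ℝ≥0∞) + 1 ≤ x := by
            rw [hx]; gcongr; exact hm.2
          have h3 := rearr_antitone a hm.2
          gcongr
  have hroot := ENNReal.rpow_le_rpow hpow (show 0 ≤ 1 / σ by positivity)
  rw [← ENNReal.rpow_mul, mul_one_div_cancel hσ0.ne', ENNReal.rpow_one] at hroot
  have hsimp : x / 2 * (((x / 2) ^ (1 / p) * rearr a n) ^ σ / x)
      = ((x / 2) ^ (1 / p) * rearr a n) ^ σ / 2 := by
    rw [div_eq_mul_inv, div_eq_mul_inv _ x, div_eq_mul_inv _ (2 : ℝ≥0∞)]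
    calc _ = (x * x⁻¹) * ((x * 2⁻¹) ^ (1 / p) * rearr a n) ^ σ * 2⁻¹ := by ring
      _ = _ := by rw [ENNReal.mul_inv_cancel hx0 hxt, one_mul]
  rw [hsimp, ENNReal.div_rpow_of_nonneg _ _ (by positivity), ← ENNReal.rpow_mul,
    mul_one_div_cancel hσ0.ne', ENNReal.rpow_one, ENNReal.div_rpow_of_nonneg _ _ (by positivity)]
    at hroot
  have h2p : (2 : ℝ≥0∞) ^ (1 / p) ≠ 0 := by simp
  have h2p' : (2 : ℝ≥0∞) ^ (1 / p) ≠ ∞ := by simp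
  have h2s : (2 : ℝ≥0∞) ^ (1 / σ) ≠ 0 := by simp
  have h2s' : (2 : ℝ≥0∞) ^ (1 / σ) ≠ ∞ := by simp
  have hC : ((2 : ℝ≥0) ^ (1 / p + 1 / σ) : ℝ≥0) = (2 : ℝ≥0∞) ^ (1 / p) * (2 : ℝ≥0∞) ^ (1 / σ) := by
    rw [ENNReal.coe_rpow_of_ne_zero (by norm_num), ENNReal.rpow_add _ _ (by norm_num) (by norm_num)]
    norm_num
  rw [hC]
  generalize (2 : ℝ≥0∞) ^ (1 / p) = A at *
  generalize (2 : ℝ≥0∞) ^ (1 / σ) = B at *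
  generalize x ^ (1 / p) = X at *
  calc X * rearr a n = (A * A⁻¹) * (B * B⁻¹) * (X * rearr a n) := by
        rw [ENNReal.mul_inv_cancel h2p h2p', ENNReal.mul_inv_cancel h2s h2s', one_mul, one_mul]
    _ = A * B * (X / A * rearr a n / B) := by
        simp only [div_eq_mul_inv]; ring
    _ ≤ _ := by gcongr

theorem natCast_add_one_rpow_eq_ofReal (n : ℕ) (e : ℝ) :
    ((n : ℝ≥0∞) + 1) ^ e = ENNReal.ofReal (((n : ℝ) + 1) ^ e) := by
  rw [← ENNReal.ofReal_rpow_of_pos (by positivity), ENNReal.ofReal_add (by positivity) (by simp)]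
  simp

/-- The weak norm gives `a_n* ≤ n^(-1/p₁) ‖a‖_{p₁,∞}`; the strict gap `1/p₂ - 1/p₁ < 0` pushes the
exponent of the resulting series below `-1`. -/
theorem lorentzNorm_le_of_lt {p₁ p₂ : ℝ} {s : ℝ≥0∞} (hp₁ : 0 < p₁) (hp : p₁ < p₂) (hs : 0 < s) :
    ∃ C : ℝ≥0, ∀ a : ι → ℂ, lorentzNorm p₂ s a ≤ C * lorentzNorm p₁ ∞ a := by
  have hp₂ : 0 < p₂ := hp₁.trans hp
  have hinv : 1 / p₂ < 1 / p₁ := one_div_lt_one_div_of_lt hp₁ hp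
  have hterm (a : ι → ℂ) (n : ℕ) : ((n : ℝ≥0∞) + 1) ^ (1 / p₂) * rearr a n ≤
      ((n : ℝ≥0∞) + 1) ^ (1 / p₂ - 1 / p₁) * lorentzNorm p₁ ∞ a := by
    calc ((n : ℝ≥0∞) + 1) ^ (1 / p₂) * rearr a n
        = ((n : ℝ≥0∞) + 1) ^ (1 / p₂ - 1 / p₁) * (((n : ℝ≥0∞) + 1) ^ (1 / p₁) * rearr a n) := by
          rw [← mul_assoc, ← ENNReal.rpow_add _ _ (natCast_add_one_ne_zero n)
            (natCast_add_one_ne_top n), sub_add_cancel]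
      _ ≤ _ := by
          gcongr
          rw [lorentzNorm_top]
          exact le_iSup (fun n : ℕ => ((n : ℝ≥0∞) + 1) ^ (1 / p₁) * rearr a n) n
  rcases eq_or_ne s ∞ with rfl | hs'
  · refine ⟨1, fun a => ?_⟩
    rw [lorentzNorm_top p₂]
    refine iSup_le fun n => (hterm a n).trans ?_
    gcongr
    rw [ENNReal.coe_one]
    exact ENNReal.rpow_le_one_of_one_le_of_neg (by simp) (by linarith)
  set σ := s.toReal with hσ
  have hσ0 : 0 < σ := ENNReal.toReal_pos hs.ne' hs'
  set e := (1 / p₂ - 1 / p₁) * σ - 1 with he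
  have he1 : e < -1 := by
    have : (1 / p₂ - 1 / p₁) * σ < 0 := mul_neg_of_neg_of_pos (by linarith) hσ0
    linarith
  set T : ℝ≥0∞ := ∑' n : ℕ, ((n : ℝ≥0∞) + 1) ^ e with hT
  have hTfin : T ≠ ∞ := by
    have h1 : Summable fun n : ℕ => ((n : ℝ) + 1) ^ e := by
      have := (summable_nat_add_iff 1).2 (Real.summable_nat_rpow.2 he1)
      simpa using this
    rw [hT]
    simp_rw [natCast_add_one_rpow_eq_ofReal]
    exact h1.tsum_ofReal_ne_top
  have hTr : T ^ (1 / σ) ≠ ∞ := ENNReal.rpow_ne_top_of_nonneg (by positivity) hTfin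
  refine ⟨(T ^ (1 / σ)).toNNReal, fun a => ?_⟩
  rw [ENNReal.coe_toNNReal hTr]
  have hpow : lorentzNorm p₂ s a ^ σ ≤ T * lorentzNorm p₁ ∞ a ^ σ := by
    rw [lorentzNorm_rpow hs hs', hT, ← ENNReal.tsum_mul_right]
    refine ENNReal.tsum_le_tsum fun n => ?_
    calc (((n : ℝ≥0∞) + 1) ^ (1 / p₂) * rearr a n) ^ σ / ((n : ℝ≥0∞) + 1)
        ≤ (((n : ℝ≥0∞) + 1) ^ (1 / p₂ - 1 / p₁) * lorentzNorm p₁ ∞ a) ^ σ / ((n : ℝ≥0∞) + 1) := by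
          gcongr ?_ ^ σ / _; exact hterm a n
      _ = ((n : ℝ≥0∞) + 1) ^ e * lorentzNorm p₁ ∞ a ^ σ := by
          rw [ENNReal.mul_rpow_of_nonneg _ _ hσ0.le, ← ENNReal.rpow_mul, he, ENNReal.rpow_sub _ _
            (natCast_add_one_ne_zero n) (natCast_add_one_ne_top n), ENNReal.rpow_one,
            div_eq_mul_inv ((_ : ℝ≥0∞) ^ ((1 / p₂ - 1 / p₁) * σ)), div_eq_mul_inv]
          exact mul_right_comm _ _ _
  have hroot := ENNReal.rpow_le_rpow hpow (show 0 ≤ 1 / σ by positivity)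
  rwa [ENNReal.mul_rpow_of_nonneg _ _ (by positivity), ← ENNReal.rpow_mul, ← ENNReal.rpow_mul,
    mul_one_div_cancel hσ0.ne', ENNReal.rpow_one, ENNReal.rpow_one] at hroot

/-- The power `s₂` is split as `(s₂ - s₁) + s₁`; the first factor is bounded by the weak norm, the
second is summed. -/
theorem lorentzNorm_le_of_second_le {p : ℝ} {s₁ s₂ : ℝ≥0∞} (hp : 0 < p) (hs₁ : 0 < s₁)
    (hs : s₁ ≤ s₂) :
    ∃ C : ℝ≥0, ∀ a : ι → ℂ, lorentzNorm p s₂ a ≤ C * lorentzNorm p s₁ a := by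
  obtain ⟨C, hC⟩ := lorentzNorm_top_le (ι := ι) hp hs₁
  rcases eq_or_ne s₂ ∞ with rfl | hs₂'
  · exact ⟨C, hC⟩
  have hs₁' : s₁ ≠ ∞ := ne_top_of_le_ne_top hs₂' hs
  have hs₂ : 0 < s₂ := hs₁.trans_le hs
  have h1 : 0 < s₁.toReal := ENNReal.toReal_pos hs₁.ne' hs₁'
  have h2 : 0 < s₂.toReal := ENNReal.toReal_pos hs₂.ne' hs₂'
  have h12 : s₁.toReal ≤ s₂.toReal := ENNReal.toReal_mono hs₂' hs
  refine ⟨C ^ ((s₂.toReal - s₁.toReal) * (1 / s₂.toReal)), fun a => ?_⟩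
  set K := lorentzNorm p s₁ a with hK
  have hpow : lorentzNorm p s₂ a ^ s₂.toReal ≤
      (C : ℝ≥0∞) ^ (s₂.toReal - s₁.toReal) * K ^ s₂.toReal := by
    rw [lorentzNorm_rpow hs₂ hs₂']
    calc _ ≤ ∑' n : ℕ, (C * K) ^ (s₂.toReal - s₁.toReal) *
          ((((n : ℝ≥0∞) + 1) ^ (1 / p) * rearr a n) ^ s₁.toReal / ((n : ℝ≥0∞) + 1)) := by
          refine ENNReal.tsum_le_tsum fun n => ?_
          have hn : ((n : ℝ≥0∞) + 1) ^ (1 / p) * rearr a n ≤ C * K := by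
            refine le_trans ?_ (hC a)
            rw [lorentzNorm_top]
            exact le_iSup (fun n : ℕ => ((n : ℝ≥0∞) + 1) ^ (1 / p) * rearr a n) n
          calc _ = (((n : ℝ≥0∞) + 1) ^ (1 / p) * rearr a n) ^ (s₂.toReal - s₁.toReal) *
              ((((n : ℝ≥0∞) + 1) ^ (1 / p) * rearr a n) ^ s₁.toReal / ((n : ℝ≥0∞) + 1)) := by
                rw [← mul_div_assoc, ← ENNReal.rpow_add_of_nonneg _ _ (by linarith) h1.le,
                  sub_add_cancel]
            _ ≤ _ := by
                gcongr
      _ = (C * K) ^ (s₂.toReal - s₁.toReal) * K ^ s₁.toReal := by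
          rw [ENNReal.tsum_mul_left, ← lorentzNorm_rpow hs₁ hs₁']
      _ = _ := by
          rw [ENNReal.mul_rpow_of_nonneg _ _ (by linarith), mul_assoc,
            ← ENNReal.rpow_add_of_nonneg _ _ (by linarith) h1.le, sub_add_cancel]
  have hroot := ENNReal.rpow_le_rpow hpow (show 0 ≤ 1 / s₂.toReal by positivity)
  rw [ENNReal.mul_rpow_of_nonneg _ _ (by positivity), ← ENNReal.rpow_mul, ← ENNReal.rpow_mul,
    ← ENNReal.rpow_mul, mul_one_div_cancel h2.ne', ENNReal.rpow_one, ENNReal.rpow_one] at hroot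
  rwa [ENNReal.coe_rpow_of_nonneg _ (mul_nonneg (by linarith) (by positivity))]

/-- The continuous embeddings between Lorentz sequence spaces. -/
theorem lorentzNorm_embedding {p₁ p₂ : ℝ} {s₁ s₂ : ℝ≥0∞} (hp₁ : 0 < p₁) (hs₁ : 0 < s₁)
    (hs₂ : 0 < s₂) (h : p₁ < p₂ ∨ (p₁ = p₂ ∧ s₁ ≤ s₂)) :
    ∃ C : ℝ≥0, ∀ a : ι → ℂ, lorentzNorm p₂ s₂ a ≤ C * lorentzNorm p₁ s₁ a := by
  rcases h with h | ⟨rfl, h⟩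
  · obtain ⟨C₁, hC₁⟩ := lorentzNorm_top_le (ι := ι) hp₁ hs₁
    obtain ⟨C₂, hC₂⟩ := lorentzNorm_le_of_lt (ι := ι) hp₁ h hs₂
    refine ⟨C₂ * C₁, fun a => (hC₂ a).trans ?_⟩
    rw [ENNReal.coe_mul, mul_assoc]
    gcongr
    exact hC₁ a
  · exact lorentzNorm_le_of_second_le hp₁ hs₁ h

end Lorentz

/-! ### Discrete Hardy-Littlewood-Sobolev inequality and dyadic condensation -/

section DoubleSums

/-- Bernoulli's inequality for the concave power gives `N^α ≤ (N+1)^α - α (N+1)^(α-1)`, which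
telescopes. -/
theorem sum_natCast_add_one_rpow_le {α : ℝ} (hα₀ : 0 < α) (hα₁ : α < 1) (N : ℕ) :
    ∑ j ∈ Finset.range N, ((j : ℝ) + 1) ^ (α - 1) ≤ (N : ℝ) ^ α / α := by
  induction N with
  | zero => simp [hα₀.ne']
  | succ N ih =>
    rw [Finset.sum_range_succ]
    have hx : (0 : ℝ) < (N : ℝ) + 1 := by positivity
    have hb := rpow_one_add_le_one_add_mul_self (s := -(1 / ((N : ℝ) + 1))) (p := α)
      (by rw [neg_le_neg_iff, div_le_one hx]; simp) hα₀.le hα₁.le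
    have hN : (N : ℝ) = ((N : ℝ) + 1) * (1 + -(1 / ((N : ℝ) + 1))) := by field_simp; ring
    have h0 : 0 ≤ 1 + -(1 / ((N : ℝ) + 1)) := by
      rw [← sub_eq_add_neg, sub_nonneg, div_le_one hx]; simp
    have h1 : (N : ℝ) ^ α ≤ ((N : ℝ) + 1) ^ α - α * ((N : ℝ) + 1) ^ (α - 1) := by
      calc (N : ℝ) ^ α = ((N : ℝ) + 1) ^ α * (1 + -(1 / ((N : ℝ) + 1))) ^ α := by
            rw [← Real.mul_rpow hx.le h0, ← hN]
        _ ≤ ((N : ℝ) + 1) ^ α * (1 + α * -(1 / ((N : ℝ) + 1))) := by gcongr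
        _ = _ := by rw [Real.rpow_sub_one hx.ne']; field_simp; ring
    have h2 : (N : ℝ) ^ α / α ≤ ((N : ℝ) + 1) ^ α / α - ((N : ℝ) + 1) ^ (α - 1) := by
      rw [div_le_iff₀ hα₀, sub_mul, div_mul_cancel₀ _ hα₀.ne']
      linarith
    push_cast
    linarith

/-- The kernel `(1 + |l|) ^ (α - 1)` on `ℤ`. -/
noncomputable def decayKernel (α : ℝ) (l : ℤ) : ℝ≥0∞ := ((l.natAbs : ℝ≥0∞) + 1) ^ (α - 1)

theorem decayKernel_sub_comm (α : ℝ) (n m : ℤ) :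
    decayKernel α (n - m) = decayKernel α (m - n) := by
  rw [decayKernel, decayKernel, ← Int.natAbs_neg, neg_sub]

theorem enn_rpow_le_rpow_of_nonpos {x y : ℝ≥0∞} {e : ℝ} (he : e ≤ 0) (h : x ≤ y) :
    y ^ e ≤ x ^ e := by
  obtain ⟨d, rfl⟩ : ∃ d, e = -d := ⟨-e, by simp⟩
  rw [ENNReal.rpow_neg, ENNReal.rpow_neg, ENNReal.inv_le_inv]
  exact ENNReal.rpow_le_rpow h (by linarith)

/-- Of the points of `E`, those at distance less than `N` from `n` occur at most twice per distance
and contribute at most `(2/α) N^α`; each of the others, at most `N` in number, contributes at most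
`N^(α-1)`. The bound depends on `E` only through its size, which is why rearrangements suffice. -/
theorem sum_decayKernel_le {α : ℝ} (hα₀ : 0 < α) (hα₁ : α < 1) (n : ℤ) {N : ℕ} (hN : 0 < N)
    (E : Finset ℤ) (hE : E.card ≤ N) :
    ∑ m ∈ E, decayKernel α (n - m) ≤ ENNReal.ofReal (2 / α + 1) * (N : ℝ≥0∞) ^ α := by
  have hN0 : (N : ℝ≥0∞) ≠ 0 := by exact_mod_cast hN.ne'
  have hN0' : (0 : ℝ) < N := by exact_mod_cast hN
  rw [← Finset.sum_filter_add_sum_filter_not E (fun m => (n - m).natAbs < N),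
    ENNReal.ofReal_add (by positivity) (by norm_num), add_mul]
  refine add_le_add ?_ ?_
  · rw [← Finset.sum_fiberwise_of_maps_to (s := E.filter fun m => (n - m).natAbs < N)
      (t := Finset.range N) (g := fun m => (n - m).natAbs) (by simp)]
    calc _ ≤ ∑ j ∈ Finset.range N, ENNReal.ofReal (2 * ((j : ℝ) + 1) ^ (α - 1)) := by
          refine Finset.sum_le_sum fun j _ => ?_
          have hcard : ((E.filter fun m => (n - m).natAbs < N).filter
              fun m => (n - m).natAbs = j).card ≤ 2 := by
            refine le_trans (Finset.card_le_card ?_) (Finset.card_le_two (a := n - j) (b := n + j))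
            intro m hm
            simp only [Finset.mem_filter, Finset.mem_insert, Finset.mem_singleton] at hm ⊢
            omega
          rw [ENNReal.ofReal_mul (by norm_num), ← natCast_add_one_rpow_eq_ofReal]
          calc _ = ∑ _m ∈ (E.filter (fun m => (n - m).natAbs < N)).filter
                (fun m => (n - m).natAbs = j), ((j : ℝ≥0∞) + 1) ^ (α - 1) := by
                refine Finset.sum_congr rfl fun m hm => ?_
                rw [decayKernel, (Finset.mem_filter.1 hm).2]
            _ ≤ ENNReal.ofReal 2 * ((j : ℝ≥0∞) + 1) ^ (α - 1) := by
                rw [Finset.sum_const, nsmul_eq_mul, ENNReal.ofReal_ofNat]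
                gcongr
                exact_mod_cast hcard
      _ ≤ ENNReal.ofReal (2 / α * (N : ℝ) ^ α) := by
          rw [← ENNReal.ofReal_sum_of_nonneg (fun j _ => by positivity), ← Finset.mul_sum]
          refine ENNReal.ofReal_le_ofReal ?_
          have := sum_natCast_add_one_rpow_le hα₀ hα₁ N
          calc _ ≤ 2 * ((N : ℝ) ^ α / α) := by gcongr
            _ = _ := by ring
      _ = _ := by
          rw [ENNReal.ofReal_mul (by positivity), ← ENNReal.ofReal_rpow_of_pos hN0',
            ENNReal.ofReal_natCast]
  · calc _ ≤ ∑ _m ∈ E.filter (fun m => ¬ (n - m).natAbs < N), (N : ℝ≥0∞) ^ (α - 1) := by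
          refine Finset.sum_le_sum fun m hm => ?_
          refine enn_rpow_le_rpow_of_nonpos (by linarith) ?_
          have h : N ≤ (n - m).natAbs := not_lt.1 (Finset.mem_filter.1 hm).2
          calc (N : ℝ≥0∞) ≤ ((n - m).natAbs : ℝ≥0∞) := by exact_mod_cast h
            _ ≤ _ := le_self_add
      _ ≤ N * (N : ℝ≥0∞) ^ (α - 1) := by
          rw [Finset.sum_const, nsmul_eq_mul]
          gcongr
          exact (Finset.card_filter_le _ _).trans hE
      _ = _ := by
          rw [ENNReal.ofReal_one, one_mul, ENNReal.rpow_sub _ _ hN0 (by simp), ENNReal.rpow_one,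
            ENNReal.mul_div_cancel hN0 (by simp)]

theorem tsum_tsum_le_of_symm (F : ℕ → ℕ → ℝ≥0∞) (hF : ∀ μ ν, F μ ν = F ν μ) :
    ∑' μ, ∑' ν, F μ ν ≤ 2 * ∑' μ, ∑' k, F μ (μ + k) := by
  have hup : ∑' μ, ∑' ν, (if μ ≤ ν then F μ ν else 0) = ∑' μ, ∑' k, F μ (μ + k) := by
    refine tsum_congr fun μ => ?_
    rw [← (add_right_injective μ).tsum_eq (f := fun ν => if μ ≤ ν then F μ ν else 0)]
    · simp
    · intro ν hν
      have : μ ≤ ν := by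
        by_contra h
        simp [h] at hν
      exact ⟨ν - μ, by simp [this]⟩
  have hlow : ∑' μ, ∑' ν, (if ν ≤ μ then F μ ν else 0) = ∑' μ, ∑' k, F μ (μ + k) := by
    rw [ENNReal.tsum_comm, ← hup]
    exact tsum_congr fun ν => tsum_congr fun μ => by rw [hF]
  calc ∑' μ, ∑' ν, F μ ν
      ≤ ∑' μ, ∑' ν, ((if μ ≤ ν then F μ ν else 0) + (if ν ≤ μ then F μ ν else 0)) := by
        refine ENNReal.tsum_le_tsum fun μ => ENNReal.tsum_le_tsum fun ν => ?_
        rcases le_total μ ν with h | h <;> simp [h]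
    _ = _ := by
        simp_rw [ENNReal.tsum_add]
        rw [hup, hlow, two_mul]

/-- A symmetric double series whose terms decay geometrically away from the diagonal. -/
theorem tsum_tsum_le_of_offDiag {F : ℕ → ℕ → ℝ≥0∞} (hF : ∀ μ ν, F μ ν = F ν μ) (A : ℝ≥0∞)
    (v θ : ℕ → ℝ≥0∞) (h : ∀ μ k, F μ (μ + k) ≤ A * (v μ * v (μ + k) * θ k)) :
    ∑' μ, ∑' ν, F μ ν ≤ 4 * A * (∑' k, θ k) * ∑' ν, v ν ^ 2 := by
  have hamgm (x y : ℝ≥0∞) : x * y ≤ x ^ 2 + y ^ 2 := by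
    rcases le_total x y with hxy | hxy
    · calc x * y ≤ y * y := by gcongr
        _ ≤ _ := by rw [← sq]; exact le_add_self
    · calc x * y ≤ x * x := by gcongr
        _ ≤ _ := by rw [← sq]; exact le_self_add
  have hk (k : ℕ) : ∑' μ, (v μ ^ 2 + v (μ + k) ^ 2) ≤ 2 * ∑' ν, v ν ^ 2 := by
    rw [ENNReal.tsum_add, two_mul]
    refine add_le_add le_rfl ?_
    exact ENNReal.tsum_comp_le_tsum_of_injective (add_left_injective k) fun ν => v ν ^ 2
  calc ∑' μ, ∑' ν, F μ ν ≤ 2 * ∑' μ, ∑' k, F μ (μ + k) := tsum_tsum_le_of_symm F hF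
    _ ≤ 2 * ∑' μ, ∑' k, A * ((v μ ^ 2 + v (μ + k) ^ 2) * θ k) := by
        gcongr with μ k
        refine (h μ k).trans ?_
        gcongr
        exact hamgm _ _
    _ = 2 * (A * ∑' k, (∑' μ, (v μ ^ 2 + v (μ + k) ^ 2)) * θ k) := by
        rw [ENNReal.tsum_comm]
        simp_rw [ENNReal.tsum_mul_left, ENNReal.tsum_mul_right]
    _ ≤ 2 * (A * ∑' k, (2 * ∑' ν, v ν ^ 2) * θ k) := by
        gcongr with k
        exact hk k
    _ = _ := by rw [ENNReal.tsum_mul_left]; ring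

theorem tsum_two_pow_rpow_neg_ne_top {η : ℝ} (hη : 0 < η) :
    ∑' k : ℕ, ((2 : ℝ≥0∞) ^ k) ^ (-η) ≠ ∞ := by
  have h (k : ℕ) : ((2 : ℝ≥0∞) ^ k) ^ (-η) = ((2 : ℝ≥0∞) ^ (-η)) ^ k := by
    rw [← ENNReal.rpow_natCast, ← ENNReal.rpow_mul, mul_comm, ENNReal.rpow_mul,
      ENNReal.rpow_natCast]
  simp_rw [h]
  rw [ENNReal.tsum_geometric]
  have : (2 : ℝ≥0∞) ^ (-η) < 1 :=
    ENNReal.rpow_lt_one_of_one_lt_of_neg (by norm_num) (by linarith)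
  simpa [tsub_eq_zero_iff_le] using this

theorem tsum_ite_mul_eq_sum {ι : Type*} [DecidableEq ι] (E : Finset ι) (x : ℝ≥0∞)
    (g : ι → ℝ≥0∞) :
    ∑' n, (if n ∈ E then x else 0) * g n = x * ∑ n ∈ E, g n := by
  rw [tsum_eq_sum (s := E), Finset.mul_sum]
  · exact Finset.sum_congr rfl fun n hn => by rw [if_pos hn]
  · intro n hn; rw [if_neg hn, zero_mul]

/-- The discrete Hardy-Littlewood-Sobolev inequality for sequences that are dominated by dyadic
blocks. -/
theorem tsum_tsum_decayKernel_le {α : ℝ} (hα₀ : 0 < α) (hα₁ : α < 1) :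
    ∃ C : ℝ≥0, ∀ (b : ℤ → ℝ≥0∞) (x : ℕ → ℝ≥0∞) (E : ℕ → Finset ℤ),
      (∀ ν, (E ν).card ≤ 2 ^ (ν + 1)) → (∀ n, b n ≤ ∑' ν, if n ∈ E ν then x ν else 0) →
      ∑' n, ∑' m, b n * b m * decayKernel α (n - m) ≤
        C * ∑' ν, ((2 : ℝ≥0∞) ^ ν) ^ (1 + α) * x ν ^ 2 := by
  set c := ENNReal.ofReal (2 / α + 1) with hc
  set A : ℝ≥0∞ := 2 * (2 : ℝ≥0∞) ^ α * c with hA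
  set θ : ℕ → ℝ≥0∞ := fun k => ((2 : ℝ≥0∞) ^ k) ^ (-((1 - α) / 2)) with hθ
  have hθt : ∑' k, θ k ≠ ∞ := tsum_two_pow_rpow_neg_ne_top (by linarith)
  have hAt : A ≠ ∞ := by
    refine ENNReal.mul_ne_top (ENNReal.mul_ne_top (by simp) ?_) ENNReal.ofReal_ne_top
    exact ENNReal.rpow_ne_top_of_nonneg hα₀.le (by simp)
  have hCt : 4 * A * ∑' k, θ k ≠ ∞ := ENNReal.mul_ne_top (ENNReal.mul_ne_top (by simp) hAt) hθt
  refine ⟨(4 * A * ∑' k, θ k).toNNReal, fun b x E hE hb => ?_⟩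
  rw [ENNReal.coe_toNNReal hCt]
  set F : ℕ → ℕ → ℝ≥0∞ := fun μ ν =>
    x μ * (x ν * ∑ n ∈ E μ, ∑ m ∈ E ν, decayKernel α (n - m)) with hF
  have hsymm (μ ν : ℕ) : F μ ν = F ν μ := by
    simp only [hF]
    rw [mul_left_comm, Finset.sum_comm]
    simp_rw [decayKernel_sub_comm α]
  have hoff (μ k : ℕ) : F μ (μ + k) ≤ A * ((x μ * ((2 : ℝ≥0∞) ^ μ) ^ ((1 + α) / 2)) *
      (x (μ + k) * ((2 : ℝ≥0∞) ^ (μ + k)) ^ ((1 + α) / 2)) * θ k) := by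
    -- The kernel is summed over the larger block and the points of the smaller one are merely
    -- counted. Relative to the balanced weights `2^(μ(1+α)/2) 2^((μ+k)(1+α)/2)` this order gains
    -- `2^(kα - k(1+α)/2) = 2^(-k(1-α)/2)`, that is, `θ k`.
    have hsum : ∑ n ∈ E μ, ∑ m ∈ E (μ + k), decayKernel α (n - m) ≤
        2 ^ (μ + 1) * (c * ((2 : ℝ≥0∞) ^ (μ + k + 1)) ^ α) := by
      calc _ ≤ ∑ _n ∈ E μ, c * ((2 : ℝ≥0∞) ^ (μ + k + 1)) ^ α := by
            refine Finset.sum_le_sum fun n _ => ?_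
            have := sum_decayKernel_le hα₀ hα₁ n (N := 2 ^ (μ + k + 1)) (by positivity)
              (E (μ + k)) (hE _)
            simpa using this
        _ ≤ _ := by
            rw [Finset.sum_const, nsmul_eq_mul]
            gcongr
            exact_mod_cast hE μ
    have hid : (2 : ℝ≥0∞) ^ (μ + 1) * (c * ((2 : ℝ≥0∞) ^ (μ + k + 1)) ^ α) =
        A * (((2 : ℝ≥0∞) ^ μ) ^ ((1 + α) / 2) * ((2 : ℝ≥0∞) ^ (μ + k)) ^ ((1 + α) / 2) * θ k) := by
      simp only [hθ, hA]
      rw [pow_succ, pow_succ, pow_add]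
      have hM : (2 : ℝ≥0∞) ^ μ ≠ 0 := by simp
      have hM' : (2 : ℝ≥0∞) ^ μ ≠ ∞ := by finiteness
      have hK : (2 : ℝ≥0∞) ^ k ≠ 0 := by simp
      have hK' : (2 : ℝ≥0∞) ^ k ≠ ∞ := by finiteness
      generalize (2 : ℝ≥0∞) ^ μ = M at *
      generalize (2 : ℝ≥0∞) ^ k = K at *
      have e1 : M * M ^ α = M ^ ((1 + α) / 2) * M ^ ((1 + α) / 2) := by
        nth_rw 1 [← ENNReal.rpow_one M]
        rw [← ENNReal.rpow_add _ _ hM hM', ← ENNReal.rpow_add _ _ hM hM']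
        congr 1; ring
      have e2 : K ^ α = K ^ ((1 + α) / 2) * K ^ (-((1 - α) / 2)) := by
        rw [← ENNReal.rpow_add _ _ hK hK']
        congr 1; ring
      rw [ENNReal.mul_rpow_of_nonneg _ _ hα₀.le, ENNReal.mul_rpow_of_nonneg _ _ hα₀.le,
        ENNReal.mul_rpow_of_nonneg _ _ (by linarith : 0 ≤ (1 + α) / 2), e2]
      generalize (2 : ℝ≥0∞) ^ α = B at *
      generalize M ^ ((1 + α) / 2) = M₁ at *
      generalize M ^ α = M₂ at *
      generalize K ^ ((1 + α) / 2) = K₁ at *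
      generalize K ^ (-((1 - α) / 2)) = K₂ at *
      calc _ = 2 * B * c * (M * M₂) * K₁ * K₂ := by ring
        _ = _ := by rw [e1]; ring
    calc F μ (μ + k) ≤ x μ * (x (μ + k) * (2 ^ (μ + 1) * (c * ((2 : ℝ≥0∞) ^ (μ + k + 1)) ^ α))) := by
          simp only [hF]
          gcongr
      _ = _ := by rw [hid]; ring
  have hmain := tsum_tsum_le_of_offDiag hsymm A
    (fun ν => x ν * ((2 : ℝ≥0∞) ^ ν) ^ ((1 + α) / 2)) θ hoff
  calc ∑' n, ∑' m, b n * b m * decayKernel α (n - m)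
      ≤ ∑' n, ∑' m, (∑' μ, if n ∈ E μ then x μ else 0) * (∑' ν, if m ∈ E ν then x ν else 0) *
          decayKernel α (n - m) := by
        gcongr with n m
        · exact hb n
        · exact hb m
    _ = ∑' n, ∑' m, ∑' μ, ∑' ν, (if n ∈ E μ then x μ else 0) * ((if m ∈ E ν then x ν else 0) *
          decayKernel α (n - m)) := by
        refine tsum_congr fun n => tsum_congr fun m => ?_
        rw [← ENNReal.tsum_mul_right, ← ENNReal.tsum_mul_right]
        refine tsum_congr fun μ => ?_
        rw [mul_assoc, ← ENNReal.tsum_mul_right, ← ENNReal.tsum_mul_left]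
    _ = ∑' μ, ∑' ν, ∑' n, ∑' m, (if n ∈ E μ then x μ else 0) * ((if m ∈ E ν then x ν else 0) *
          decayKernel α (n - m)) := by
        calc _ = ∑' n, ∑' μ, ∑' m, ∑' ν, (if n ∈ E μ then x μ else 0) *
              ((if m ∈ E ν then x ν else 0) * decayKernel α (n - m)) :=
              tsum_congr fun n => ENNReal.tsum_comm
          _ = ∑' n, ∑' μ, ∑' ν, ∑' m, (if n ∈ E μ then x μ else 0) *
              ((if m ∈ E ν then x ν else 0) * decayKernel α (n - m)) :=
              tsum_congr fun n => tsum_congr fun μ => ENNReal.tsum_comm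
          _ = ∑' μ, ∑' n, ∑' ν, ∑' m, (if n ∈ E μ then x μ else 0) *
              ((if m ∈ E ν then x ν else 0) * decayKernel α (n - m)) := ENNReal.tsum_comm
          _ = _ := tsum_congr fun μ => ENNReal.tsum_comm
    _ = ∑' μ, ∑' ν, F μ ν := by
        refine tsum_congr fun μ => tsum_congr fun ν => ?_
        simp_rw [ENNReal.tsum_mul_left, tsum_ite_mul_eq_sum, hF, Finset.mul_sum]
    _ ≤ _ := hmain
    _ = _ := by
        congr 1
        refine tsum_congr fun ν => ?_
        have hM : (2 : ℝ≥0∞) ^ ν ≠ 0 := by simp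
        have hM' : (2 : ℝ≥0∞) ^ ν ≠ ∞ := by finiteness
        rw [mul_pow, mul_comm, sq (((2 : ℝ≥0∞) ^ ν) ^ ((1 + α) / 2)), ← ENNReal.rpow_add _ _ hM hM']
        congr 2; ring

/-- Cauchy condensation for the rearrangement with an increasing weight. -/
theorem tsum_two_pow_rearr_le {ι : Type*} {α : ℝ} (hα₀ : 0 < α) (a : ι → ℂ) :
    ∑' ν : ℕ, ((2 : ℝ≥0∞) ^ ν) ^ (1 + α) * rearr a (2 ^ ν - 1) ^ 2 ≤
      (1 + 2 ^ (1 + α)) * ∑' n : ℕ, ((n : ℝ≥0∞) + 1) ^ α * rearr a n ^ 2 := by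
  rw [tsum_eq_zero_add' ENNReal.summable, add_mul, one_mul]
  refine add_le_add ?_ ?_
  · calc _ = (((0 : ℕ) : ℝ≥0∞) + 1) ^ α * rearr a 0 ^ 2 := by simp
      _ ≤ _ := ENNReal.le_tsum (f := fun n : ℕ => ((n : ℝ≥0∞) + 1) ^ α * rearr a n ^ 2) 0
  · rw [← ENNReal.tsum_mul_left]
    calc _ ≤ ∑' ν : ℕ, ∑' n : ℕ, if Nat.log 2 (n + 1) = ν then
          2 ^ (1 + α) * (((n : ℝ≥0∞) + 1) ^ α * rearr a n ^ 2) else 0 := by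
          refine ENNReal.tsum_le_tsum fun ν => ?_
          -- The term with index `ν + 1` is charged to the preceding block of `2^ν` entries, where
          -- the rearrangement is larger. These blocks are the fibres of `Nat.log 2 (n + 1)`, hence
          -- disjoint.
          refine le_trans ?_ (ENNReal.sum_le_tsum (Finset.Ico (2 ^ ν - 1) (2 ^ (ν + 1) - 1)))
          have hcard : (Finset.Ico (2 ^ ν - 1) (2 ^ (ν + 1) - 1)).card = 2 ^ ν := by
            rw [Nat.card_Ico, pow_succ]; have := Nat.one_le_two_pow (n := ν); omega
          calc _ = ∑ _n ∈ Finset.Ico (2 ^ ν - 1) (2 ^ (ν + 1) - 1), (2 : ℝ≥0∞) ^ (1 + α) *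
                (((2 : ℝ≥0∞) ^ ν) ^ α * rearr a (2 ^ (ν + 1) - 1) ^ 2) := by
                rw [Finset.sum_const, hcard, nsmul_eq_mul, pow_succ (2 : ℝ≥0∞),
                  ENNReal.mul_rpow_of_nonneg _ _ (by linarith : 0 ≤ 1 + α),
                  ENNReal.rpow_add 1 α (by simp : (2 : ℝ≥0∞) ^ ν ≠ 0) (by finiteness),
                  ENNReal.rpow_one]
                push_cast
                ring
            _ ≤ _ := by
                refine Finset.sum_le_sum fun n hn => ?_
                rw [Finset.mem_Ico] at hn
                have h1 : 2 ^ ν ≤ n + 1 := by omega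
                have h2 : n + 1 < 2 ^ (ν + 1) := by omega
                rw [if_pos (Nat.log_eq_of_pow_le_of_lt_pow h1 h2)]
                have h3 : (2 : ℝ≥0∞) ^ ν ≤ (n : ℝ≥0∞) + 1 := by exact_mod_cast h1
                have h4 := rearr_antitone a hn.2.le
                gcongr
      _ = _ := by
          rw [ENNReal.tsum_comm]
          refine tsum_congr fun n => ?_
          rw [tsum_eq_single (Nat.log 2 (n + 1)) (fun ν hν => if_neg hν.symm), if_pos rfl]

/-- Cauchy condensation for the rearrangement with a decreasing weight. -/
theorem tsum_rearr_le_two_pow {ι : Type*} {α : ℝ} (hα₀ : 0 < α) (a : ι → ℂ) :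
    ∑' n : ℕ, ((n : ℝ≥0∞) + 1) ^ (-α) * rearr a n ^ 2 ≤
      ∑' ν : ℕ, ((2 : ℝ≥0∞) ^ ν) ^ (1 - α) * rearr a (2 ^ ν - 1) ^ 2 := by
  -- Condensation needs entries counted from `1`, whereas `rearr` counts from `0`; the value at `0`
  -- is padding.
  set f : ℕ → ℝ≥0∞ := fun n => if n = 0 then 0 else (n : ℝ≥0∞) ^ (-α) * rearr a (n - 1) ^ 2 with hf
  have hmono : ∀ ⦃m n⦄, 0 < m → m ≤ n → f n ≤ f m := by
    intro m n hm hmn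
    simp only [hf, hm.ne', (hm.trans_le hmn).ne', if_false]
    refine mul_le_mul' ?_ (pow_le_pow_left' ?_ 2)
    · exact enn_rpow_le_rpow_of_nonpos (by linarith) (by exact_mod_cast hmn)
    · exact rearr_antitone a (by omega)
  have h := ENNReal.le_tsum_condensed hmono
  rw [tsum_eq_zero_add' ENNReal.summable] at h
  simp only [hf, if_true, zero_add, Nat.add_sub_cancel, Nat.succ_ne_zero, if_false] at h
  push_cast at h
  refine h.trans (le_of_eq (tsum_congr fun ν => ?_))
  rw [if_neg (by positivity), ← mul_assoc, sub_eq_add_neg,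
    ENNReal.rpow_add 1 (-α) (by simp : (2 : ℝ≥0∞) ^ ν ≠ 0) (by finiteness), ENNReal.rpow_one]

end DoubleSums

/-! ### Duality between `H α` and `H (-α)` -/

section Weights

theorem measurable_weight (lam : ℝ) : Measurable (weight lam) := by
  unfold weight
  fun_prop

theorem toReal_weight (lam t : ℝ) : (weight lam t).toReal = |t| ^ lam := by
  rw [weight, ← ENNReal.toReal_rpow, ENNReal.toReal_ofReal (abs_nonneg t)]

theorem ae_ne_zero_restrict (s : Set ℝ) : ∀ᵐ t ∂(volume.restrict s : Measure ℝ), t ≠ 0 :=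
  ae_restrict_of_ae (by simp [ae_iff])

theorem weight_ne_zero {t : ℝ} (ht : t ≠ 0) (lam : ℝ) : weight lam t ≠ 0 := by
  simp [weight, ht]

theorem weight_ne_top {t : ℝ} (ht : t ≠ 0) (lam : ℝ) : weight lam t ≠ ∞ := by
  rw [weight, ENNReal.ofReal_rpow_of_pos (abs_pos.2 ht)]
  exact ENNReal.ofReal_ne_top

theorem absolutelyContinuous_weightMeasure (lam : ℝ) :
    volume.restrict (Set.Icc (-1 / 2 : ℝ) (1 / 2)) ≪ weightMeasure lam :=
  withDensity_absolutelyContinuous' (measurable_weight lam).aemeasurable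
    ((ae_ne_zero_restrict _).mono fun _ ht => weight_ne_zero ht lam)

theorem integral_weightMeasure (lam : ℝ) (g : ℝ → ℂ) :
    ∫ t, g t ∂(weightMeasure lam) =
      ∫ t in Set.Icc (-1 / 2 : ℝ) (1 / 2), ((|t| ^ lam : ℝ) : ℂ) * g t := by
  rw [weightMeasure, integral_withDensity_eq_integral_toReal_smul (measurable_weight lam)
    ((ae_ne_zero_restrict _).mono fun _ ht => (weight_ne_top ht lam).lt_top)]
  simp_rw [toReal_weight, Complex.real_smul]

/-- Half of the weight is moved into each factor, so that the Hölder inequality for Lebesgue measure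
applies and the weights of exponents `α` and `-α` cancel. -/
theorem eLpNorm_weightMeasure {lam : ℝ} {f : ℝ → ℂ}
    (hf : AEStronglyMeasurable f (volume.restrict (Set.Icc (-1 / 2 : ℝ) (1 / 2)))) :
    eLpNorm f 2 (weightMeasure lam) =
      (∫⁻ t in Set.Icc (-1 / 2 : ℝ) (1 / 2), (‖f t‖ₑ * weight lam t ^ (1 / 2 : ℝ)) ^ (2 : ℝ)) ^
        (1 / 2 : ℝ) := by
  rw [eLpNorm_eq_lintegral_rpow_enorm_toReal (by simp) (by simp), weightMeasure,
    lintegral_withDensity_eq_lintegral_mul₀ (measurable_weight lam).aemeasurable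
      (hf.enorm.pow_const _)]
  simp only [ENNReal.toReal_ofNat, Pi.mul_apply]
  congr 1
  refine lintegral_congr fun t => ?_
  rw [ENNReal.mul_rpow_of_nonneg _ _ (by norm_num : (0 : ℝ) ≤ 2), ← ENNReal.rpow_mul]
  norm_num
  rw [mul_comm]

/-- The Cauchy-Schwarz inequality for the duality between `H_α` and `H_{-α}`. -/
theorem lintegral_enorm_mul_le (α : ℝ) {f g : ℝ → ℂ}
    (hf : AEStronglyMeasurable f (volume.restrict (Set.Icc (-1 / 2 : ℝ) (1 / 2))))
    (hg : AEStronglyMeasurable g (volume.restrict (Set.Icc (-1 / 2 : ℝ) (1 / 2)))) :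
    ∫⁻ t in Set.Icc (-1 / 2 : ℝ) (1 / 2), ‖f t‖ₑ * ‖g t‖ₑ ≤
      eLpNorm f 2 (weightMeasure α) * eLpNorm g 2 (weightMeasure (-α)) := by
  rw [eLpNorm_weightMeasure hf, eLpNorm_weightMeasure hg]
  have h := ENNReal.lintegral_mul_le_Lp_mul_Lq
    (volume.restrict (Set.Icc (-1 / 2 : ℝ) (1 / 2))) Real.HolderConjugate.two_two
    (f := fun t => ‖f t‖ₑ * weight α t ^ (1 / 2 : ℝ))
    (g := fun t => ‖g t‖ₑ * weight (-α) t ^ (1 / 2 : ℝ))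
    (hf.enorm.mul ((measurable_weight α).pow_const _).aemeasurable)
    (hg.enorm.mul ((measurable_weight (-α)).pow_const _).aemeasurable)
  refine le_trans (le_of_eq (lintegral_congr_ae ?_)) h
  filter_upwards [ae_ne_zero_restrict (Set.Icc (-1 / 2 : ℝ) (1 / 2))] with t ht
  have h1 : weight α t ^ (1 / 2 : ℝ) * weight (-α) t ^ (1 / 2 : ℝ) = 1 := by
    rw [← ENNReal.mul_rpow_of_nonneg _ _ (by norm_num), weight, weight,
      ← ENNReal.rpow_add _ _ (by simpa using ht) ENNReal.ofReal_ne_top]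
    simp
  simp only [Pi.mul_apply]
  rw [mul_mul_mul_comm, h1, mul_one]

theorem aestronglyMeasurable_coe_H {lam : ℝ} (f : H lam) (μ : Measure ℝ) :
    AEStronglyMeasurable (f : ℝ → ℂ) μ :=
  (Lp.stronglyMeasurable f).aestronglyMeasurable

theorem continuous_tau (n : ℤ) : Continuous (tau n) := by
  unfold tau
  fun_prop

theorem norm_tau (n : ℤ) (t : ℝ) : ‖tau n t‖ = 1 := by
  have h : (2 * Real.pi * Complex.I * n * t : ℂ)
      = ((2 * Real.pi * n * t : ℝ) : ℂ) * Complex.I := by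
    push_cast; ring
  rw [tau, h, Complex.norm_exp_ofReal_mul_I]

theorem tau_zero (t : ℝ) : tau 0 t = 1 := by simp [tau]

theorem conj_tau (n : ℤ) (t : ℝ) :
    (starRingEnd ℂ) (tau n t) = Complex.exp (-(2 * Real.pi * Complex.I * n * t)) := by
  have h2 : (starRingEnd ℂ) 2 = 2 := Complex.conj_ofNat 2
  rw [tau, ← Complex.exp_conj]
  simp [h2]

theorem tau_mul_conj_tau (n m : ℤ) (t : ℝ) :
    tau m t * (starRingEnd ℂ) (tau n t) = tau (m - n) t := by
  rw [conj_tau, tau, tau, ← Complex.exp_add]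
  push_cast
  ring_nf

/-- Cauchy-Schwarz against the constant function `τ_0 = 1`, which belongs to `H (-α)` because `α <
1`. -/
theorem lintegral_enorm_le {α : ℝ} (hα₁ : α < 1) (f : H α) :
    ∫⁻ t in Set.Icc (-1 / 2 : ℝ) (1 / 2), ‖(f : ℝ → ℂ) t‖ₑ ≤
      ‖f‖ₑ * ‖tauH (neg_lt_neg hα₁) 0‖ₑ := by
  have h := lintegral_enorm_mul_le α (aestronglyMeasurable_coe_H f _)
    (continuous_tau 0).aestronglyMeasurable
  simpa [tau_zero, Lp.enorm_def f, tauH, Lp.enorm_toLp] using h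

theorem integrableOn_coe_H {α : ℝ} (hα₁ : α < 1) (f : H α) :
    IntegrableOn (f : ℝ → ℂ) (Set.Icc (-1 / 2 : ℝ) (1 / 2)) volume := by
  refine ⟨aestronglyMeasurable_coe_H f _, (lintegral_enorm_le hα₁ f).trans_lt ?_⟩
  exact ENNReal.mul_lt_top enorm_lt_top enorm_lt_top

theorem fourierCoeffs_eq (f : ℝ → ℂ) (n : ℤ) :
    fourierCoeffs f n =
      ∫ t in Set.Icc (-1 / 2 : ℝ) (1 / 2), f t * (starRingEnd ℂ) (tau n t) := by
  simp_rw [fourierCoeffs, conj_tau]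

theorem integrableOn_mul_conj_tau {f : ℝ → ℂ}
    (hf : IntegrableOn f (Set.Icc (-1 / 2 : ℝ) (1 / 2)) volume) (n : ℤ) :
    IntegrableOn (fun t => f t * (starRingEnd ℂ) (tau n t)) (Set.Icc (-1 / 2 : ℝ) (1 / 2))
      volume := by
  refine hf.mul_bdd (c := 1) ?_ (Eventually.of_forall fun t => ?_)
  · exact (Complex.continuous_conj.comp (continuous_tau n)).aestronglyMeasurable
  · rw [RCLike.norm_conj, norm_tau]

theorem enorm_fourierCoeffs_le {α : ℝ} (hα₁ : α < 1) (f : H α) (n : ℤ) :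
    ‖fourierCoeffs f n‖ₑ ≤ ‖f‖ₑ * ‖tauH (neg_lt_neg hα₁) 0‖ₑ := by
  rw [fourierCoeffs_eq]
  refine (enorm_integral_le_lintegral_enorm _).trans (le_trans (le_of_eq ?_)
    (lintegral_enorm_le hα₁ f))
  refine lintegral_congr fun t => ?_
  rw [enorm_mul, ← ofReal_norm ((starRingEnd ℂ) (tau n t)), RCLike.norm_conj, norm_tau]
  simp

theorem sum_smul_toLp_ae {ι : Type*} {μ : Measure ℝ} (F : Finset ι) (c : ι → ℂ)
    {φ : ι → ℝ → ℂ} (hφ : ∀ i, MemLp (φ i) 2 μ) :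
    ((∑ i ∈ F, c i • (hφ i).toLp (φ i) : Lp ℂ 2 μ) : ℝ → ℂ) =ᵐ[μ]
      fun t => ∑ i ∈ F, c i * φ i t := by
  classical
  induction F using Finset.induction_on with
  | empty => simpa using! Lp.coeFn_zero ℂ 2 μ
  | insert i F hi ih =>
    rw [Finset.sum_insert hi]
    filter_upwards [Lp.coeFn_add (c i • (hφ i).toLp (φ i)) (∑ i ∈ F, c i • (hφ i).toLp (φ i)),
      Lp.coeFn_smul (c i) ((hφ i).toLp (φ i)), (hφ i).coeFn_toLp, ih] with t h1 h2 h3 h4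
    rw [h1, Pi.add_apply, h2, Pi.smul_apply, h3, h4, Finset.sum_insert hi, smul_eq_mul]

/-- The duality between the Fourier coefficient transform on `H_α` and the Fourier series transform
into `H_{-α}`. -/
theorem enorm_sum_conj_mul_fourierCoeffs_le {α : ℝ} (hα₁ : α < 1) (f : H α) (F : Finset ℤ)
    (a : ℤ → ℂ) :
    ‖∑ n ∈ F, (starRingEnd ℂ) (a n) * fourierCoeffs f n‖ₑ ≤
      ‖f‖ₑ * ‖∑ n ∈ F, a n • tauH (neg_lt_neg hα₁) n‖ₑ := by
  have hint := integrableOn_coe_H hα₁ f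
  set G : ℝ → ℂ := fun t => ∑ n ∈ F, a n * tau n t with hG
  have hGc : Continuous G := by
    have := continuous_tau
    fun_prop
  have hsum : ∑ n ∈ F, (starRingEnd ℂ) (a n) * fourierCoeffs f n =
      ∫ t in Set.Icc (-1 / 2 : ℝ) (1 / 2), (f : ℝ → ℂ) t * (starRingEnd ℂ) (G t) := by
    have h1 (t : ℝ) : (f : ℝ → ℂ) t * (starRingEnd ℂ) (G t) = ∑ n ∈ F,
        (starRingEnd ℂ) (a n) * ((f : ℝ → ℂ) t * (starRingEnd ℂ) (tau n t)) := by
      rw [hG, map_sum, Finset.mul_sum]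
      refine Finset.sum_congr rfl fun n _ => ?_
      rw [map_mul]; ring
    simp_rw [h1]
    rw [integral_finsetSum _ fun n _ => (integrableOn_mul_conj_tau hint n).const_mul _]
    refine Finset.sum_congr rfl fun n _ => ?_
    rw [integral_const_mul, fourierCoeffs_eq]
  have hnorm : ‖∑ n ∈ F, a n • tauH (neg_lt_neg hα₁) n‖ₑ = eLpNorm G 2 (weightMeasure (-α)) := by
    rw [Lp.enorm_def]
    exact eLpNorm_congr_ae (sum_smul_toLp_ae F a (memLp_tau (neg_lt_neg hα₁)))
  rw [hsum, hnorm, Lp.enorm_def f]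
  refine (enorm_integral_le_lintegral_enorm _).trans (le_trans (le_of_eq ?_)
    (lintegral_enorm_mul_le α (aestronglyMeasurable_coe_H f _) hGc.aestronglyMeasurable))
  refine lintegral_congr fun t => ?_
  rw [enorm_mul, ← ofReal_norm ((starRingEnd ℂ) (G t)), RCLike.norm_conj,
    ofReal_norm]

/-- Expansion through the Gram matrix. It serves twice: for the exponentials in `H (-α)` and for the
tents in `H α`. -/
theorem enorm_sum_smul_sq_le {ι V : Type*} [NormedAddCommGroup V] [InnerProductSpace ℂ V]
    (F : Finset ι) (c : ι → ℂ) (v : ι → V) :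
    ‖∑ i ∈ F, c i • v i‖ₑ ^ 2 ≤
      ∑ i ∈ F, ∑ j ∈ F, ‖c i‖ₑ * ‖c j‖ₑ * ‖inner ℂ (v i) (v j)‖ₑ := by
  have h (w : V) : ‖w‖ₑ ^ 2 = ‖inner ℂ w w‖ₑ := by
    rw [inner_self_eq_norm_sq_to_K, enorm_pow]
    congr 1
    rw [← ofReal_norm, ← ofReal_norm]
    simp
  rw [h, sum_inner]
  refine (enorm_sum_le _ _).trans (Finset.sum_le_sum fun i _ => ?_)
  rw [inner_sum]
  refine (enorm_sum_le _ _).trans (Finset.sum_le_sum fun j _ => ?_)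
  rw [inner_smul_left, inner_smul_right, enorm_mul, enorm_mul, ← ofReal_norm,
    RCLike.norm_conj, ofReal_norm, mul_assoc]

end Weights

/-! ### Decay of the Fourier coefficients of `|t|^(-α)` -/

section Oscillation

theorem intervalIntegrable_ofReal {f : ℝ → ℝ} {a b : ℝ} (hf : IntervalIntegrable f volume a b) :
    IntervalIntegrable (fun t => (f t : ℂ)) volume a b :=
  ⟨hf.1.ofReal, hf.2.ofReal⟩

theorem intervalIntegral_congr_of_eqOn_uIoc {f g : ℝ → ℂ} {a b : ℝ}
    (h : Set.EqOn f g (Set.uIoc a b)) : ∫ t in a..b, f t = ∫ t in a..b, g t :=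
  intervalIntegral.integral_congr_ae (Eventually.of_forall fun _ ht => h ht)

theorem norm_exp_mul_I (ω t : ℝ) : ‖Complex.exp (ω * t * Complex.I)‖ = 1 := by
  rw [← Complex.ofReal_mul, Complex.norm_exp_ofReal_mul_I]

/-- The integral is split at `δ = 1/|ω|`. Below `δ` there is no useful oscillation and the absolute
integral is `δ^(1-α)/(1-α)`; above `δ` an integration by parts gains `1/|ω|`. The assumption `2 ≤
|ω|` places `δ` in the interval. -/
theorem norm_integral_rpow_mul_exp_le {α : ℝ} (hα₀ : 0 < α) (hα₁ : α < 1) {ω : ℝ}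
    (hω : 2 ≤ |ω|) :
    ‖∫ t in (0 : ℝ)..(1 / 2), ((t ^ (-α) : ℝ) : ℂ) * Complex.exp (ω * t * Complex.I)‖ ≤
      (1 / (1 - α) + 2) * |ω| ^ (α - 1) := by
  set δ : ℝ := |ω|⁻¹ with hδ
  have hω0 : 0 < |ω| := by linarith
  have hωne : ω ≠ 0 := abs_pos.1 hω0
  have hδ0 : 0 < δ := by positivity
  have hδ1 : δ ≤ 1 / 2 := by
    rw [hδ, one_div]
    exact inv_anti₀ (by norm_num) hω
  have hint (a b : ℝ) : IntervalIntegrable (fun t : ℝ => ((t ^ (-α) : ℝ) : ℂ) *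
      Complex.exp (ω * t * Complex.I)) volume a b := by
    refine IntervalIntegrable.mul_continuousOn ?_ (by fun_prop)
    exact intervalIntegrable_ofReal (intervalIntegral.intervalIntegrable_rpow' (by linarith))
  rw [← intervalIntegral.integral_add_adjacent_intervals (hint 0 δ) (hint δ (1 / 2)), add_mul]
  have hδpow : δ ^ (1 - α) = |ω| ^ (α - 1) := by
    rw [hδ, Real.inv_rpow hω0.le, ← Real.rpow_neg hω0.le, neg_sub]
  refine (norm_add_le _ _).trans (add_le_add ?_ ?_)
  · calc _ ≤ ∫ t in (0 : ℝ)..δ, t ^ (-α) := by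
          refine intervalIntegral.norm_integral_le_of_norm_le hδ0.le
            (Eventually.of_forall fun t ht => ?_)
            (intervalIntegral.intervalIntegrable_rpow' (by linarith))
          rw [norm_mul, norm_exp_mul_I, mul_one, Complex.norm_real, Real.norm_of_nonneg]
          exact Real.rpow_nonneg ht.1.le _
      _ = _ := by
          rw [integral_rpow (Or.inl (by linarith)), Real.zero_rpow (by linarith), ← hδpow,
            neg_add_eq_sub]
          ring
  · have h0 : (0 : ℝ) ∉ Set.uIcc δ (1 / 2) := by
      rw [Set.uIcc_of_le hδ1]; exact fun h => absurd h.1 hδ0.not_ge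
    have hpos : ∀ t ∈ Set.uIcc δ (1 / 2), 0 < t := by
      rw [Set.uIcc_of_le hδ1]; exact fun t ht => hδ0.trans_le ht.1
    have hu : ∀ t ∈ Set.uIcc δ (1 / 2), HasDerivAt (fun t : ℝ => ((t ^ (-α) : ℝ) : ℂ))
        ((-α * t ^ (-α - 1) : ℝ) : ℂ) t := fun t ht =>
      (Real.hasDerivAt_rpow_const (Or.inl (hpos t ht).ne')).ofReal_comp
    have hωI : (ω : ℂ) * Complex.I ≠ 0 := mul_ne_zero (by exact_mod_cast hωne) Complex.I_ne_zero
    have hv : ∀ t ∈ Set.uIcc δ (1 / 2), HasDerivAt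
        (fun t : ℝ => Complex.exp (ω * t * Complex.I) / (ω * Complex.I))
        (Complex.exp (ω * t * Complex.I)) t := by
      intro t _
      have h1 : HasDerivAt (fun t : ℝ => (ω : ℂ) * t * Complex.I) (ω * Complex.I) t := by
        have := ((Complex.ofRealCLM.hasDerivAt (x := t)).const_mul (ω : ℂ)).mul_const Complex.I
        simpa using this
      have h2 := h1.cexp.div_const (ω * Complex.I)
      rwa [mul_div_assoc, div_self hωI, mul_one] at h2
    have hu' : IntervalIntegrable (fun t : ℝ => -α * t ^ (-α - 1)) volume δ (1 / 2) :=
      (intervalIntegral.intervalIntegrable_rpow (Or.inr h0)).const_mul _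
    rw [intervalIntegral.integral_mul_deriv_eq_deriv_mul hu hv (intervalIntegrable_ofReal hu')
      (Continuous.intervalIntegrable (by fun_prop) _ _)]
    have hvn (t : ℝ) : ‖Complex.exp (ω * t * Complex.I) / (ω * Complex.I)‖ = δ := by
      rw [norm_div, norm_exp_mul_I, norm_mul, Complex.norm_I, mul_one, Complex.norm_real,
        Real.norm_eq_abs, one_div]
    have hun {t : ℝ} (ht : 0 < t) : ‖((t ^ (-α) : ℝ) : ℂ)‖ = t ^ (-α) := by
      rw [Complex.norm_real, Real.norm_of_nonneg (Real.rpow_nonneg ht.le _)]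
    have hI : ‖∫ t in δ..(1 / 2), ((-α * t ^ (-α - 1) : ℝ) : ℂ) *
        (Complex.exp (ω * t * Complex.I) / (ω * Complex.I))‖ ≤
        (δ ^ (-α) - (1 / 2) ^ (-α)) * δ := by
      calc _ ≤ ∫ t in δ..(1 / 2), (α * δ) * t ^ (-α - 1) := by
            refine intervalIntegral.norm_integral_le_of_norm_le hδ1
              (Eventually.of_forall fun t ht => ?_)
              ((intervalIntegral.intervalIntegrable_rpow (Or.inr h0)).const_mul _)
            have ht0 : 0 < t := hδ0.trans ht.1
            rw [norm_mul, hvn, Complex.norm_real, norm_mul, norm_neg, Real.norm_of_nonneg hα₀.le,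
              Real.norm_of_nonneg (Real.rpow_nonneg ht0.le _)]
            exact le_of_eq (by ring)
        _ = _ := by
            rw [intervalIntegral.integral_const_mul,
              integral_rpow (Or.inr ⟨by linarith, h0⟩), sub_add_cancel]
            field_simp
            ring
    have hfin : δ ^ (-α) * δ = |ω| ^ (α - 1) := by
      rw [← hδpow]
      nth_rw 2 [← Real.rpow_one δ]
      rw [← Real.rpow_add hδ0, neg_add_eq_sub]
    -- The boundary term at `1/2` cancels against the negative term in `hI`, leaving exactly `2
    -- δ^(1-α)`.
    refine (norm_sub_le _ _).trans ?_
    refine (add_le_add (norm_sub_le _ _) hI).trans ?_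
    rw [norm_mul, norm_mul, hvn, hvn, hun hδ0, hun (by norm_num)]
    rw [← hfin]
    exact le_of_eq (by ring)

theorem integral_abs_rpow_mul_tau {α : ℝ} (hα₁ : α < 1) (l : ℤ) :
    ∫ t, tau l t ∂(weightMeasure (-α)) =
      (∫ t in (0 : ℝ)..(1 / 2), ((t ^ (-α) : ℝ) : ℂ) *
        Complex.exp ((-(2 * Real.pi * l) : ℝ) * t * Complex.I)) +
      ∫ t in (0 : ℝ)..(1 / 2), ((t ^ (-α) : ℝ) : ℂ) *
        Complex.exp ((2 * Real.pi * l : ℝ) * t * Complex.I) := by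
  set g : ℝ → ℂ := fun t => ((|t| ^ (-α) : ℝ) : ℂ) * tau l t with hg
  have hpos : Set.EqOn (fun t : ℝ => ((t ^ (-α) : ℝ) : ℂ) *
        Complex.exp ((2 * Real.pi * l : ℝ) * t * Complex.I)) g (Set.uIoc 0 (1 / 2)) := by
    intro t ht
    rw [Set.uIoc_of_le (by norm_num)] at ht
    simp only [hg, abs_of_pos ht.1, tau]
    congr 2
    push_cast; ring
  have hneg : Set.EqOn (fun t : ℝ => ((t ^ (-α) : ℝ) : ℂ) *
        Complex.exp ((-(2 * Real.pi * l) : ℝ) * t * Complex.I)) (fun t => g (-t))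
        (Set.uIoc 0 (1 / 2)) := by
    intro t ht
    rw [Set.uIoc_of_le (by norm_num)] at ht
    simp only [hg, abs_neg, abs_of_pos ht.1, tau]
    congr 2
    push_cast; ring
  have hint (ω : ℝ) (a b : ℝ) : IntervalIntegrable (fun t : ℝ => ((t ^ (-α) : ℝ) : ℂ) *
      Complex.exp (ω * t * Complex.I)) volume a b := by
    refine IntervalIntegrable.mul_continuousOn ?_ (by fun_prop)
    exact intervalIntegrable_ofReal (intervalIntegral.intervalIntegrable_rpow' (by linarith))
  have hi1 : IntervalIntegrable g volume 0 (1 / 2) := (hint _ _ _).congr hpos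
  have hi2 : IntervalIntegrable g volume (-1 / 2) 0 := by
    have h := ((hint _ 0 (1 / 2)).congr hneg).comp_sub_left 0
    simp only [zero_sub, neg_neg, neg_zero] at h
    rw [neg_div]
    exact h.symm
  rw [integral_weightMeasure, integral_Icc_eq_integral_Ioc,
    ← intervalIntegral.integral_of_le (by norm_num),
    ← intervalIntegral.integral_add_adjacent_intervals hi2 hi1]
  congr 1
  · rw [intervalIntegral_congr_of_eqOn_uIoc hneg, intervalIntegral.integral_comp_neg g, neg_zero,
      neg_div]
  · exact (intervalIntegral_congr_of_eqOn_uIoc hpos).symm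

theorem inner_tauH {lam : ℝ} (hlam : -1 < lam) (n m : ℤ) :
    inner ℂ (tauH hlam n) (tauH hlam m) = ∫ t, tau (m - n) t ∂(weightMeasure lam) := by
  rw [L2.inner_def]
  refine integral_congr_ae ?_
  filter_upwards [(memLp_tau hlam n).coeFn_toLp, (memLp_tau hlam m).coeFn_toLp] with t h1 h2
  rw [tauH, tauH, h1, h2, RCLike.inner_apply, tau_mul_conj_tau]

/-- Decay of the Fourier coefficients of the weight `|t| ^ (-α)`. -/
theorem exists_enorm_inner_tauH_le {α : ℝ} (hα₀ : 0 < α) (hα₁ : α < 1) :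
    ∃ C : ℝ≥0, ∀ n m : ℤ,
      ‖inner ℂ (tauH (neg_lt_neg hα₁) n) (tauH (neg_lt_neg hα₁) m)‖ₑ ≤
        C * decayKernel α (n - m) := by
  set C₀ : ℝ := ‖∫ t, tau 0 t ∂(weightMeasure (-α))‖ with hC₀
  set C₁ : ℝ := 2 * (1 / (1 - α) + 2) with hC₁
  have h1α : 0 < 1 - α := by linarith
  have hC₀0 : 0 ≤ C₀ := norm_nonneg _
  have hC₁0 : 0 ≤ C₁ := by positivity
  refine ⟨(C₀ + C₁).toNNReal, fun n m => ?_⟩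
  rw [inner_tauH, decayKernel_sub_comm, decayKernel, natCast_add_one_rpow_eq_ofReal,
    ← ofReal_norm]
  rw [show (((C₀ + C₁).toNNReal : ℝ≥0) : ℝ≥0∞) = ENNReal.ofReal (C₀ + C₁) from rfl,
    ← ENNReal.ofReal_mul (by positivity)]
  refine ENNReal.ofReal_le_ofReal ?_
  generalize m - n = l
  rcases eq_or_ne l 0 with rfl | hl
  · simp only [Int.natAbs_zero, Nat.cast_zero, zero_add, Real.one_rpow, mul_one]
    linarith
  · have hl1 : (1 : ℝ) ≤ |(l : ℝ)| := by exact_mod_cast Int.one_le_abs hl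
    have hlabs : ((l.natAbs : ℕ) : ℝ) = |(l : ℝ)| := by
      rw [Nat.cast_natAbs, Int.cast_abs]
    have hω : |2 * Real.pi * (l : ℝ)| = 2 * Real.pi * |(l : ℝ)| := by
      rw [abs_mul, abs_of_pos Real.two_pi_pos]
    have hπ := Real.pi_gt_three
    -- For `l ≠ 0` the frequency `2π|l|` dominates `|l| + 1`, which turns the decay in `ω` into
    -- `decayKernel`; the case `l = 0` is absorbed by `C₀`.
    have hω2 : |(l : ℝ)| + 1 ≤ |2 * Real.pi * (l : ℝ)| := by
      rw [hω]; nlinarith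
    have hω3 : 2 ≤ |2 * Real.pi * (l : ℝ)| := by linarith
    have h1 := norm_integral_rpow_mul_exp_le hα₀ hα₁ hω3
    have h2 := norm_integral_rpow_mul_exp_le hα₀ hα₁ (ω := -(2 * Real.pi * (l : ℝ)))
      (by rwa [abs_neg])
    rw [abs_neg] at h2
    have h3 : |2 * Real.pi * (l : ℝ)| ^ (α - 1) ≤ (|(l : ℝ)| + 1) ^ (α - 1) :=
      Real.rpow_le_rpow_of_nonpos (by positivity) hω2 (by linarith)
    rw [integral_abs_rpow_mul_tau hα₁, hlabs]
    calc _ ≤ _ := norm_add_le _ _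
      _ ≤ C₁ * |2 * Real.pi * (l : ℝ)| ^ (α - 1) := by rw [hC₁]; linarith
      _ ≤ C₁ * (|(l : ℝ)| + 1) ^ (α - 1) := by gcongr
      _ ≤ _ := by gcongr; linarith

/-- The norm in `H_{-α}` of a trigonometric polynomial is controlled by a discrete
Hardy-Littlewood-Sobolev form of its coefficients. -/
theorem exists_enorm_sum_tauH_sq_le {α : ℝ} (hα₀ : 0 < α) (hα₁ : α < 1) :
    ∃ C : ℝ≥0, ∀ (F : Finset ℤ) (a : ℤ → ℂ),
      ‖∑ n ∈ F, a n • tauH (neg_lt_neg hα₁) n‖ₑ ^ 2 ≤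
        C * ∑ n ∈ F, ∑ m ∈ F, ‖a n‖ₑ * ‖a m‖ₑ * decayKernel α (n - m) := by
  obtain ⟨C, hC⟩ := exists_enorm_inner_tauH_le hα₀ hα₁
  refine ⟨C, fun F a => (enorm_sum_smul_sq_le F a _).trans ?_⟩
  simp_rw [Finset.mul_sum]
  refine Finset.sum_le_sum fun n _ => Finset.sum_le_sum fun m _ => ?_
  calc _ ≤ ‖a n‖ₑ * ‖a m‖ₑ * (C * decayKernel α (n - m)) := by gcongr; exact hC n m
    _ = _ := by ring

end Oscillation

/-! ### Boundedness at the critical indices with `s = 2` -/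

section Boundedness

/-- For `p = 2/(1+α)` and `p = 2/(1-α)` the weight exponent `2/p - 1` becomes `α` and `-α`, matching
the two condensation lemmas. -/
theorem lorentzNorm_two_sq {ι : Type*} (p : ℝ) (a : ι → ℂ) :
    lorentzNorm p 2 a ^ 2 = ∑' n : ℕ, ((n : ℝ≥0∞) + 1) ^ (2 / p - 1) * rearr a n ^ 2 := by
  have h := lorentzNorm_rpow (p := p) (s := 2) (by norm_num) (by norm_num) a
  simp only [ENNReal.toReal_ofNat, ENNReal.rpow_two] at h
  rw [h]
  refine tsum_congr fun n => ?_
  rw [mul_pow, ← ENNReal.rpow_two (((n : ℝ≥0∞) + 1) ^ (1 / p)), ← ENNReal.rpow_mul,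
    ENNReal.rpow_sub _ _ (natCast_add_one_ne_zero n) (natCast_add_one_ne_top n), ENNReal.rpow_one,
    one_div_mul_eq_div, div_eq_mul_inv, div_eq_mul_inv ((_ : ℝ≥0∞) ^ (2 / p))]
  exact mul_right_comm _ _ _

theorem le_of_sq_le_sq_enn {x y : ℝ≥0∞} (h : x ^ 2 ≤ y ^ 2) : x ≤ y :=
  (ENNReal.pow_le_pow_left_iff two_ne_zero).1 h

theorem exists_finset_forall_mem_iff_rearr_lt {ι : Type*} (a : ι → ℂ) (n : ℕ) :
    ∃ E : Finset ι, E.card ≤ n ∧ ∀ k, k ∈ E ↔ rearr a n < ‖a k‖ₑ := by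
  have h := encard_rearr_lt_le a n
  have hfin : {k : ι | rearr a n < ‖a k‖ₑ}.Finite := Set.finite_of_encard_le_coe h
  refine ⟨hfin.toFinset, ?_, fun k => by simp⟩
  rw [hfin.encard_eq_coe_toFinset_card] at h
  exact_mod_cast h

/-- The value `rearr a n` may only be approached, not reached, by `n + 1` of the moduli; halving it
leaves the necessary room. -/
theorem exists_finset_card_eq_rearr_half_le {ι : Type*} [Infinite ι] {a : ι → ℂ} {n : ℕ}
    (h : rearr a n ≠ ∞) :
    ∃ E : Finset ι, E.card = n + 1 ∧ ∀ k ∈ E, rearr a n / 2 ≤ ‖a k‖ₑ := by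
  rcases eq_or_ne (rearr a n) 0 with h0 | h0
  · obtain ⟨E, hE⟩ := Infinite.exists_subset_card_eq ι (n + 1)
    exact ⟨E, hE, fun k _ => by simp [h0]⟩
  · have hlt := lt_encard_of_lt_rearr (ENNReal.half_lt_self h0 h)
    obtain ⟨t, hts, ht⟩ := Set.exists_subset_encard_eq (Order.add_one_le_of_lt hlt)
    have hfin : t.Finite := by
      refine Set.finite_of_encard_eq_coe (k := n + 1) ?_
      rw [ht]; norm_cast
    refine ⟨hfin.toFinset, ?_, fun k hk => le_of_lt (hts (by simpa using hk))⟩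
    rw [hfin.encard_eq_coe_toFinset_card] at ht
    exact_mod_cast ht

theorem natArr_bijective : Function.Bijective natArr := by
  constructor
  · intro k l h
    simp only [natArr, Nat.even_iff] at h
    split_ifs at h <;> omega
  · intro z
    rcases lt_or_ge 0 z with hz | hz
    · refine ⟨2 * (z - 1).toNat + 1, ?_⟩
      rw [natArr, if_neg (by rw [Nat.even_iff]; omega)]
      omega
    · refine ⟨2 * (-z).toNat, ?_⟩
      rw [natArr, if_pos (by rw [Nat.even_iff]; omega)]
      omega

/-- The discrete Hardy-Littlewood-Sobolev inequality on `ℓ_{q,2}`, `q = 2 / (1 + α)`. -/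
theorem tsum_tsum_decayKernel_le_lorentzNorm {α : ℝ} (hα₀ : 0 < α) (hα₁ : α < 1) :
    ∃ C : ℝ≥0, ∀ a : ℤ → ℂ, MemLorentz (2 / (1 + α)) 2 a →
      ∑' n, ∑' m, ‖a n‖ₑ * ‖a m‖ₑ * decayKernel α (n - m) ≤
        C * lorentzNorm (2 / (1 + α)) 2 a ^ 2 := by
  obtain ⟨C, hC⟩ := tsum_tsum_decayKernel_le hα₀ hα₁
  refine ⟨C * (1 + 2 ^ (1 + α)), fun a ha => ?_⟩
  have hexp : 2 / (2 / (1 + α)) - 1 = α := by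
    have : 1 + α ≠ 0 := by linarith
    field_simp; ring
  have hnorm := lorentzNorm_two_sq (2 / (1 + α)) a
  rw [hexp] at hnorm
  -- `E ν` collects the indices whose modulus exceeds the `2^(ν+1)`-th entry of the rearrangement,
  -- so it has fewer than `2^(ν+1)` members.
  choose E hE hmem using fun ν : ℕ => exists_finset_forall_mem_iff_rearr_lt a (2 ^ (ν + 1) - 1)
  have hdom (n : ℤ) : ‖a n‖ₑ ≤ ∑' ν : ℕ, if n ∈ E ν then rearr a (2 ^ ν - 1) else 0 := by
    rcases eq_or_ne (‖a n‖ₑ) 0 with h0 | h0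
    · simp [h0]
    have hex : ∃ ν, n ∈ E ν := by
      -- A nonzero entry outside every `E ν` would bound the whole rearrangement from below, and the
      -- norm would be infinite.
      by_contra! hno
      have hle (k : ℕ) : ‖a n‖ₑ ≤ rearr a k := by
        have h1 := hno k
        rw [hmem, not_lt] at h1
        refine h1.trans (rearr_antitone a ?_)
        have := (Nat.lt_two_pow_self (n := k + 1))
        omega
      have htop : lorentzNorm (2 / (1 + α)) 2 a ^ 2 = ∞ := by
        rw [hnorm, ← top_le_iff,
          ← ENNReal.tsum_const_eq_top_of_ne_zero (α := ℕ) (pow_ne_zero 2 h0)]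
        refine ENNReal.tsum_le_tsum fun k => ?_
        calc ‖a n‖ₑ ^ 2 = 1 * ‖a n‖ₑ ^ 2 := (one_mul _).symm
          _ ≤ _ := by
            gcongr
            · exact ENNReal.one_le_rpow (by simp) hα₀
            · exact hle k
      exact ENNReal.pow_ne_top ha.ne htop
    classical
    -- For the first `ν` with `n ∈ E ν`, failure of membership at `ν - 1` says precisely that `‖a n‖
    -- ≤ rearr a (2^ν - 1)`.
    set ν := Nat.find hex with hν
    have hνmem : n ∈ E ν := Nat.find_spec hex
    have hle : ‖a n‖ₑ ≤ rearr a (2 ^ ν - 1) := by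
      rcases Nat.eq_zero_or_pos ν with h | h
      · rw [h]; exact enorm_le_rearr_zero a n
      · have h1 := Nat.find_min hex (m := ν - 1) (by omega)
        rw [hmem, not_lt, Nat.sub_add_cancel h] at h1
        exact h1
    refine hle.trans (le_trans ?_ (ENNReal.le_tsum ν))
    rw [if_pos hνmem]
  calc _ ≤ _ := hC (fun n => ‖a n‖ₑ) (fun ν => rearr a (2 ^ ν - 1)) E
        (fun ν => (hE ν).trans (Nat.sub_le _ _)) hdom
    _ ≤ C * ((1 + 2 ^ (1 + α)) * lorentzNorm (2 / (1 + α)) 2 a ^ 2) := by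
        rw [hnorm]
        gcongr
        exact tsum_two_pow_rearr_le hα₀ a
    _ = _ := by
        rw [ENNReal.coe_mul, ENNReal.coe_add, ENNReal.coe_one,
          ENNReal.coe_rpow_of_nonneg _ (by linarith), ENNReal.coe_ofNat, mul_assoc]

theorem sum_sum_le_tsum_tsum (G : ℤ → ℤ → ℝ≥0∞) (F : Finset ℤ) :
    ∑ n ∈ F, ∑ m ∈ F, G n m ≤ ∑ n ∈ F, ∑' m, G n m :=
  Finset.sum_le_sum fun _ _ => ENNReal.sum_le_tsum F

/-- The quadratic form over a finite set is at most a partial sum of the convergent series of row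
sums. This yields the Cauchy criterion for every arrangement, so the series converges
unconditionally and in particular in the natural order. -/
theorem seriesTransformBounded_critical {α : ℝ} (hα₀ : 0 < α) (hα₁ : α < 1) :
    SeriesTransformBounded (neg_lt_neg hα₁) (2 / (1 + α)) 2 := by
  obtain ⟨C₁, hC₁⟩ := exists_enorm_sum_tauH_sq_le hα₀ hα₁
  obtain ⟨C₂, hC₂⟩ := tsum_tsum_decayKernel_le_lorentzNorm hα₀ hα₁
  -- The squared norm is bounded with factor `C₁ * C₂`; since `x ≤ (x + 1)²`, this constant avoids a
  -- square root.
  refine ⟨C₁ * C₂ + 1, fun a ha => ?_⟩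
  set G : ℤ → ℤ → ℝ≥0∞ := fun n m => ‖a n‖ₑ * ‖a m‖ₑ * decayKernel α (n - m) with hG
  have hfin : ∑' n, ∑' m, G n m ≠ ∞ :=
    ne_top_of_le_ne_top (ENNReal.mul_ne_top ENNReal.coe_ne_top (ENNReal.pow_ne_top ha.ne))
      (hC₂ a ha)
  have hrow (n : ℤ) : ∑' m, G n m ≠ ∞ := ENNReal.ne_top_of_tsum_ne_top hfin n
  have hF (F : Finset ℤ) : ‖∑ n ∈ F, a n • tauH (neg_lt_neg hα₁) n‖ₑ ^ 2 ≤
      C₁ * ∑ n ∈ F, ∑' m, G n m :=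
    (hC₁ F a).trans (mul_le_mul' le_rfl (sum_sum_le_tsum_tsum G F))
  have hsum : Summable fun n : ℤ => a n • tauH (neg_lt_neg hα₁) n := by
    rw [summable_iff_vanishing_norm]
    intro ε hε
    have hreal := ENNReal.summable_toReal hfin
    rw [summable_iff_vanishing_norm] at hreal
    obtain ⟨s, hs⟩ := hreal (ε ^ 2 / (C₁ + 1)) (by positivity)
    refine ⟨s, fun t ht => ?_⟩
    have h1 := hs t ht
    have h2 := hF t
    rw [← ENNReal.toReal_sum fun n _ => hrow n, Real.norm_of_nonneg ENNReal.toReal_nonneg] at h1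
    have hne : ∑ n ∈ t, ∑' m, G n m ≠ ∞ := ENNReal.sum_ne_top.2 fun n _ => hrow n
    have h3 := ENNReal.toReal_mono (ENNReal.mul_ne_top ENNReal.coe_ne_top hne) h2
    rw [ENNReal.toReal_pow, toReal_enorm, ENNReal.toReal_mul, ENNReal.coe_toReal] at h3
    refine lt_of_pow_lt_pow_left₀ 2 hε.le (h3.trans_lt ?_)
    rw [lt_div_iff₀ (by positivity)] at h1
    have : 0 ≤ (∑ n ∈ t, ∑' m, G n m).toReal := ENNReal.toReal_nonneg
    linarith
  obtain ⟨g, hg⟩ := hsum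
  refine ⟨g, ?_, ?_⟩
  · have h := (Equiv.ofBijective natArr natArr_bijective).hasSum_iff.2 hg
    exact h.tendsto_sum_nat
  · refine le_of_tendsto ((continuous_enorm.tendsto g).comp hg) (Eventually.of_forall fun F => ?_)
    refine le_of_sq_le_sq_enn ((hF F).trans ?_)
    calc C₁ * ∑ n ∈ F, ∑' m, G n m ≤ C₁ * (C₂ * lorentzNorm (2 / (1 + α)) 2 a ^ 2) := by
          gcongr
          exact (ENNReal.sum_le_tsum F).trans (hC₂ a ha)
      _ = (C₁ * C₂ : ℝ≥0) * lorentzNorm (2 / (1 + α)) 2 a ^ 2 := by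
          rw [ENNReal.coe_mul, mul_assoc]
      _ ≤ ((C₁ * C₂ + 1 : ℝ≥0) : ℝ≥0∞) ^ 2 * lorentzNorm (2 / (1 + α)) 2 a ^ 2 := by
          gcongr
          norm_cast
          nlinarith [sq_nonneg (C₁ * C₂), zero_le (a := C₁ * C₂)]
      _ = _ := by rw [mul_pow]

theorem SeriesTransformBounded.mono {lam : ℝ} {hlam : -1 < lam} {p₁ p₂ : ℝ} {s₁ s₂ : ℝ≥0∞}
    (h : SeriesTransformBounded hlam p₂ s₂) (hp₁ : 0 < p₁) (hs₁ : 0 < s₁) (hs₂ : 0 < s₂)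
    (h12 : p₁ < p₂ ∨ (p₁ = p₂ ∧ s₁ ≤ s₂)) : SeriesTransformBounded hlam p₁ s₁ := by
  obtain ⟨C, hC⟩ := h
  obtain ⟨D, hD⟩ := lorentzNorm_embedding (ι := ℤ) hp₁ hs₁ hs₂ h12
  refine ⟨C * D, fun a ha => ?_⟩
  obtain ⟨g, hg, hgn⟩ := hC a ((hD a).trans_lt (ENNReal.mul_lt_top ENNReal.coe_lt_top ha))
  refine ⟨g, hg, hgn.trans ?_⟩
  rw [ENNReal.coe_mul, mul_assoc]
  gcongr
  exact hD a

theorem CoeffTransformBounded.mono {lam : ℝ} {p₁ p₂ : ℝ} {s₁ s₂ : ℝ≥0∞}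
    (h : CoeffTransformBounded lam p₁ s₁) (hp₁ : 0 < p₁) (hs₁ : 0 < s₁) (hs₂ : 0 < s₂)
    (h12 : p₁ < p₂ ∨ (p₁ = p₂ ∧ s₁ ≤ s₂)) : CoeffTransformBounded lam p₂ s₂ := by
  obtain ⟨hint, hmem, C, hC⟩ := h
  obtain ⟨D, hD⟩ := lorentzNorm_embedding (ι := ℤ) hp₁ hs₁ hs₂ h12
  refine ⟨hint, fun f => ?_, D * C, fun f => (hD _).trans ?_⟩
  · exact (hD _).trans_lt (ENNReal.mul_lt_top ENNReal.coe_lt_top (hmem f))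
  · rw [ENNReal.coe_mul, mul_assoc]
    gcongr
    exact hC f

/-- The dual form of the Hardy-Littlewood-Sobolev inequality: pairing the Fourier coefficients of
`f ∈ H_α` with a finitely supported nonnegative sequence. -/
theorem exists_sum_mul_enorm_fourierCoeffs_sq_le {α : ℝ} (hα₀ : 0 < α) (hα₁ : α < 1) :
    ∃ C : ℝ≥0, ∀ (f : H α) (F : Finset ℤ) (b : ℤ → ℝ≥0∞), (∀ n, b n ≠ ∞) →
      (∑ n ∈ F, b n * ‖fourierCoeffs f n‖ₑ) ^ 2 ≤
        ‖f‖ₑ ^ 2 * (C * ∑' n, ∑' m, b n * b m * decayKernel α (n - m)) := by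
  obtain ⟨C, hC⟩ := exists_enorm_sum_tauH_sq_le hα₀ hα₁
  refine ⟨C, fun f F b hb => ?_⟩
  set c := fourierCoeffs f with hc
  -- `a n` has modulus `b n` and the phase of `c n`, so that the pairing has no cancellation. Where
  -- `c n = 0` the quotient is `0`, and only `‖a n‖ ≤ b n` is needed.
  set a : ℤ → ℂ := fun n => ((b n).toReal : ℂ) * (c n / ‖c n‖) with ha
  have hac (n : ℤ) : (starRingEnd ℂ) (a n) * c n = (((b n).toReal * ‖c n‖ : ℝ) : ℂ) := by
    rcases eq_or_ne (c n) 0 with h0 | h0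
    · simp [h0]
    · have h1 : (‖c n‖ : ℂ) ≠ 0 := by simpa using h0
      simp only [ha, map_mul, map_div₀, Complex.conj_ofReal]
      rw [mul_assoc, div_mul_eq_mul_div, Complex.conj_mul', Complex.ofReal_mul]
      congr 1
      field_simp
  have han (n : ℤ) : ‖a n‖ₑ ≤ b n := by
    rw [← ofReal_norm, ← ENNReal.ofReal_toReal (hb n)]
    refine ENNReal.ofReal_le_ofReal ?_
    simp only [ha, norm_mul, norm_div, Complex.norm_real, norm_norm,
      Real.norm_of_nonneg ENNReal.toReal_nonneg]
    exact mul_le_of_le_one_right ENNReal.toReal_nonneg (div_self_le_one _)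
  have hsum : ∑ n ∈ F, b n * ‖c n‖ₑ = ‖∑ n ∈ F, (starRingEnd ℂ) (a n) * c n‖ₑ := by
    simp_rw [hac]
    rw [← Complex.ofReal_sum, ← ofReal_norm, Complex.norm_real, Real.norm_of_nonneg
      (Finset.sum_nonneg fun n _ => mul_nonneg ENNReal.toReal_nonneg (norm_nonneg _)),
      ENNReal.ofReal_sum_of_nonneg
        (fun n _ => mul_nonneg ENNReal.toReal_nonneg (norm_nonneg _))]
    refine Finset.sum_congr rfl fun n _ => ?_
    rw [ENNReal.ofReal_mul ENNReal.toReal_nonneg, ENNReal.ofReal_toReal (hb n), ofReal_norm]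
  rw [hsum]
  calc _ ≤ (‖f‖ₑ * ‖∑ n ∈ F, a n • tauH (neg_lt_neg hα₁) n‖ₑ) ^ 2 := by
        gcongr
        exact enorm_sum_conj_mul_fourierCoeffs_le hα₁ f F a
    _ ≤ ‖f‖ₑ ^ 2 * (C * ∑ n ∈ F, ∑ m ∈ F, ‖a n‖ₑ * ‖a m‖ₑ * decayKernel α (n - m)) := by
        rw [mul_pow]
        gcongr
        exact hC F a
    _ ≤ ‖f‖ₑ ^ 2 * (C * ∑ n ∈ F, ∑ m ∈ F, b n * b m * decayKernel α (n - m)) := by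
        gcongr with n _ m _
        · exact han n
        · exact han m
    _ ≤ _ := by
        gcongr
        exact (sum_sum_le_tsum_tsum _ F).trans (ENNReal.sum_le_tsum F)

/-- The coefficients are tested against their own dyadic blocks. With `S` the condensed sum over the
first `N` blocks, the pairing is at least `S` and its square is at most a constant times `‖f‖² S`,
whence a bound for `S` independent of `N`. -/
theorem exists_lorentzNorm_fourierCoeffs_le {α : ℝ} (hα₀ : 0 < α) (hα₁ : α < 1) :
    ∃ C : ℝ≥0, ∀ f : H α, lorentzNorm (2 / (1 - α)) 2 (fourierCoeffs f) ≤ C * ‖f‖ₑ := by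
  obtain ⟨C₁, hC₁⟩ := exists_sum_mul_enorm_fourierCoeffs_sq_le hα₀ hα₁
  obtain ⟨C₂, hC₂⟩ := tsum_tsum_decayKernel_le hα₀ hα₁
  refine ⟨2 * (C₁ * C₂ + 1), fun f => ?_⟩
  set c := fourierCoeffs f with hc
  have hexp : 2 / (2 / (1 - α)) - 1 = -α := by
    have : 1 - α ≠ 0 := by linarith
    field_simp; ring
  have hrearr (n : ℕ) : rearr c n ≠ ∞ := by
    refine ne_top_of_le_ne_top (ENNReal.mul_ne_top enorm_ne_top enorm_ne_top)
      (rearr_le_of_encard_le (t := ‖f‖ₑ * ‖tauH (neg_lt_neg hα₁) 0‖ₑ) ?_)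
    have : {k : ℤ | ‖f‖ₑ * ‖tauH (neg_lt_neg hα₁) 0‖ₑ < ‖c k‖ₑ} = ∅ := by
      ext k
      simpa using enorm_fourierCoeffs_le hα₁ f k
    rw [this]
    simp
  set u : ℕ → ℝ≥0∞ := fun ν => rearr c (2 ^ ν - 1) / 2 with hu
  have hut (ν : ℕ) : u ν ≠ ∞ := ENNReal.div_ne_top (hrearr _) (by simp)
  choose E hE hmem using fun ν : ℕ => exists_finset_card_eq_rearr_half_le (hrearr (2 ^ ν - 1))
  have hcard (ν : ℕ) : (E ν).card = 2 ^ ν := by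
    rw [hE ν]; have := Nat.one_le_two_pow (n := ν); omega
  have hpow0 (ν : ℕ) : (2 : ℝ≥0∞) ^ ν ≠ 0 := by simp
  have hpowt (ν : ℕ) : (2 : ℝ≥0∞) ^ ν ≠ ∞ := by finiteness
  have hpart (N : ℕ) : ∑ ν ∈ Finset.range N, ((2 : ℝ≥0∞) ^ ν) ^ (1 - α) * u ν ^ 2 ≤
      ‖f‖ₑ ^ 2 * (C₁ * C₂) := by
    set S := ∑ ν ∈ Finset.range N, ((2 : ℝ≥0∞) ^ ν) ^ (1 - α) * u ν ^ 2 with hS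
    have hSt : S ≠ ∞ := ENNReal.sum_ne_top.2 fun ν _ => ENNReal.mul_ne_top
      (ENNReal.rpow_ne_top_of_nonneg (by linarith) (hpowt ν)) (ENNReal.pow_ne_top (hut ν))
    -- The weight `2^(-αν)` makes both sides equal to `S`: a block of `2^ν` entries pairs to
    -- `2^(ν(1-α)) u²`, and `2^(ν(1+α)) (2^(-αν) u)²` is the same quantity.
    set x : ℕ → ℝ≥0∞ := fun ν => if ν ∈ Finset.range N then ((2 : ℝ≥0∞) ^ ν) ^ (-α) * u ν else 0
      with hx
    set b : ℤ → ℝ≥0∞ := fun n => ∑' ν, if n ∈ E ν then x ν else 0 with hb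
    have hbsum (n : ℤ) : b n = ∑ ν ∈ Finset.range N,
        (if n ∈ E ν then ((2 : ℝ≥0∞) ^ ν) ^ (-α) * u ν else 0) := by
      simp only [hb]
      rw [tsum_eq_sum (s := Finset.range N)]
      · refine Finset.sum_congr rfl fun ν hν => ?_
        simp only [hx, if_pos hν]
      · intro ν hν
        simp only [hx, if_neg hν, ite_self]
    have hbt (n : ℤ) : b n ≠ ∞ := by
      rw [hbsum]
      refine ENNReal.sum_ne_top.2 fun ν _ => ?_
      split_ifs
      · refine ENNReal.mul_ne_top ?_ (hut ν)
        exact ENNReal.rpow_ne_top_of_ne_zero (hpow0 ν) (hpowt ν)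
      · simp
    have hlow : S ≤ ∑ n ∈ (Finset.range N).biUnion E, b n * ‖c n‖ₑ := by
      simp_rw [hbsum, Finset.sum_mul]
      rw [Finset.sum_comm, hS]
      refine Finset.sum_le_sum fun ν hν => ?_
      calc ((2 : ℝ≥0∞) ^ ν) ^ (1 - α) * u ν ^ 2
          = ∑ _n ∈ E ν, ((2 : ℝ≥0∞) ^ ν) ^ (-α) * u ν * u ν := by
            rw [Finset.sum_const, hcard, nsmul_eq_mul, sub_eq_add_neg,
              ENNReal.rpow_add _ _ (hpow0 ν) (hpowt ν), ENNReal.rpow_one]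
            push_cast
            ring
        _ ≤ ∑ n ∈ E ν, (if n ∈ E ν then ((2 : ℝ≥0∞) ^ ν) ^ (-α) * u ν else 0) * ‖c n‖ₑ := by
            refine Finset.sum_le_sum fun n hn => ?_
            rw [if_pos hn]
            gcongr
            exact hmem ν n hn
        _ ≤ _ := Finset.sum_le_sum_of_subset (Finset.subset_biUnion_of_mem E hν)
    have hup := hC₂ b x E (fun ν => by rw [hcard]; exact Nat.pow_le_pow_right (by norm_num) (by omega))
      (fun n => le_rfl)
    have hxS : ∑' ν, ((2 : ℝ≥0∞) ^ ν) ^ (1 + α) * x ν ^ 2 = S := by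
      rw [tsum_eq_sum (s := Finset.range N)]
      · refine Finset.sum_congr rfl fun ν hν => ?_
        simp only [hx, if_pos hν]
        rw [mul_pow, ← mul_assoc, sq (((2 : ℝ≥0∞) ^ ν) ^ (-α)),
          ← ENNReal.rpow_add _ _ (hpow0 ν) (hpowt ν), ← ENNReal.rpow_add _ _ (hpow0 ν) (hpowt ν)]
        congr 2; ring
      · intro ν hν
        simp only [hx, if_neg hν]
        simp
    -- Cancelling one factor `S` requires it to be finite; this is why the blocks are truncated at
    -- `N`.
    have hsq : S * S ≤ S * (‖f‖ₑ ^ 2 * (C₁ * C₂)) := by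
      calc S * S = S ^ 2 := (sq S).symm
        _ ≤ _ := pow_le_pow_left' hlow 2
        _ ≤ _ := hC₁ f _ b hbt
        _ ≤ ‖f‖ₑ ^ 2 * (C₁ * (C₂ * S)) := by
            gcongr
            exact hup.trans_eq (by rw [hxS])
        _ = _ := by ring
    rcases eq_or_ne S 0 with h0 | h0
    · rw [h0]; exact zero_le
    · exact (ENNReal.mul_le_mul_iff_right h0 hSt).1 hsq
  refine le_of_sq_le_sq_enn ?_
  calc lorentzNorm (2 / (1 - α)) 2 c ^ 2
      = ∑' n : ℕ, ((n : ℝ≥0∞) + 1) ^ (-α) * rearr c n ^ 2 := by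
        rw [lorentzNorm_two_sq, hexp]
    _ ≤ ∑' ν : ℕ, ((2 : ℝ≥0∞) ^ ν) ^ (1 - α) * rearr c (2 ^ ν - 1) ^ 2 :=
        tsum_rearr_le_two_pow hα₀ c
    _ = 4 * ∑' ν : ℕ, ((2 : ℝ≥0∞) ^ ν) ^ (1 - α) * u ν ^ 2 := by
        rw [← ENNReal.tsum_mul_left]
        refine tsum_congr fun ν => ?_
        have h2 : rearr c (2 ^ ν - 1) = 2 * u ν :=
          (ENNReal.mul_div_cancel (by simp) (by simp)).symm
        rw [h2]
        ring
    _ ≤ 4 * (‖f‖ₑ ^ 2 * (C₁ * C₂)) := by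
        gcongr
        exact ENNReal.tsum_le_of_sum_range_le hpart
    _ = 4 * ((C₁ * C₂ : ℝ≥0) : ℝ≥0∞) * ‖f‖ₑ ^ 2 := by rw [ENNReal.coe_mul]; ring
    _ ≤ 4 * ((C₁ * C₂ + 1 : ℝ≥0) : ℝ≥0∞) ^ 2 * ‖f‖ₑ ^ 2 := by
        gcongr
        norm_cast
        nlinarith [sq_nonneg (C₁ * C₂), zero_le (a := C₁ * C₂)]
    _ = _ := by
        rw [ENNReal.coe_mul, ENNReal.coe_ofNat]
        ring

theorem coeffTransformBounded_critical {α : ℝ} (hα₀ : 0 < α) (hα₁ : α < 1) :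
    CoeffTransformBounded α (2 / (1 - α)) 2 := by
  obtain ⟨C, hC⟩ := exists_lorentzNorm_fourierCoeffs_le hα₀ hα₁
  exact ⟨integrableOn_coe_H hα₁,
    fun f => (hC f).trans_lt (ENNReal.mul_lt_top ENNReal.coe_lt_top enorm_lt_top), C, hC⟩

end Boundedness

/-! ### Extremal test functions built from tents -/

section Tent

/-- The tent function of height `1` supported in `[-δ, δ]`. -/
noncomputable def tent (δ t : ℝ) : ℝ := max 0 (1 - |t| / δ)

theorem continuous_tent (δ : ℝ) : Continuous (tent δ) := by
  unfold tent
  fun_prop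

theorem tent_nonneg (δ t : ℝ) : 0 ≤ tent δ t := le_max_left _ _

theorem tent_le_one {δ : ℝ} (hδ : 0 < δ) (t : ℝ) : tent δ t ≤ 1 :=
  max_le zero_le_one (by linarith [div_nonneg (abs_nonneg t) hδ.le])

theorem tent_eq_zero {δ t : ℝ} (hδ : 0 < δ) (ht : δ ≤ |t|) : tent δ t = 0 := by
  refine max_eq_left ?_
  rw [sub_nonpos, one_le_div hδ]
  exact ht

theorem tent_of_mem {δ t : ℝ} (ht : 0 ≤ t) (htδ : t ≤ δ) : tent δ t = 1 - t / δ := by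
  rw [tent, abs_of_nonneg ht]
  refine max_eq_right ?_
  rw [sub_nonneg]
  exact div_le_one_of_le₀ htδ (ht.trans htδ)

/-- The transform of a tent is of Fejér type, hence nonnegative. Superposed tents of different
scales therefore cannot cancel each other's coefficients. -/
theorem integral_tent_mul_cos {δ ω : ℝ} (hδ : 0 < δ) (hδ' : δ ≤ 1 / 2) (hω : ω ≠ 0) :
    ∫ t in Set.Icc (-1 / 2 : ℝ) (1 / 2), tent δ t * Real.cos (ω * t) =
      2 * (1 - Real.cos (ω * δ)) / (ω ^ 2 * δ) := by
  have hc : Continuous fun t => tent δ t * Real.cos (ω * t) := by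
    have := continuous_tent δ
    fun_prop
  have hi (a b : ℝ) : IntervalIntegrable (fun t => tent δ t * Real.cos (ω * t)) volume a b :=
    hc.intervalIntegrable a b
  have hright : ∫ t in (0 : ℝ)..(1 / 2), tent δ t * Real.cos (ω * t) =
      (1 - Real.cos (ω * δ)) / (ω ^ 2 * δ) := by
    rw [← intervalIntegral.integral_add_adjacent_intervals (hi 0 δ) (hi δ (1 / 2))]
    have h2 : ∫ t in δ..(1 / 2), tent δ t * Real.cos (ω * t) = 0 := by
      rw [intervalIntegral.integral_congr (g := fun _ => (0 : ℝ))]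
      · simp
      · intro t ht
        rw [Set.uIcc_of_le hδ'] at ht
        simp only
        rw [tent_eq_zero hδ (ht.1.trans (le_abs_self t)), zero_mul]
    have h1 : ∫ t in (0 : ℝ)..δ, tent δ t * Real.cos (ω * t) =
        ∫ t in (0 : ℝ)..δ, (1 - t / δ) * Real.cos (ω * t) := by
      refine intervalIntegral.integral_congr fun t ht => ?_
      rw [Set.uIcc_of_le hδ.le] at ht
      rw [tent_of_mem ht.1 ht.2]
    have hderiv : ∀ t ∈ Set.uIcc 0 δ, HasDerivAt (fun t => (1 - t / δ) * (Real.sin (ω * t) / ω) -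
        Real.cos (ω * t) / (ω ^ 2 * δ)) ((1 - t / δ) * Real.cos (ω * t)) t := by
      intro t _
      have hlin : HasDerivAt (fun t : ℝ => ω * t) ω t := by
        simpa using (hasDerivAt_id t).const_mul ω
      have hA : HasDerivAt (fun t : ℝ => 1 - t / δ) (-(1 / δ)) t :=
        ((hasDerivAt_id t).div_const δ).const_sub 1
      have h := (hA.mul (hlin.sin.div_const ω)).sub (hlin.cos.div_const (ω ^ 2 * δ))
      refine h.congr_deriv ?_
      field_simp
      ring
    rw [h1, h2, add_zero, intervalIntegral.integral_eq_sub_of_hasDerivAt hderiv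
      (Continuous.intervalIntegrable (by fun_prop) _ _)]
    simp only [mul_zero, Real.sin_zero, Real.cos_zero, zero_div, div_self hδ.ne']
    field_simp
    ring
  have hleft : ∫ t in (-1 / 2 : ℝ)..0, tent δ t * Real.cos (ω * t) =
      ∫ t in (0 : ℝ)..(1 / 2), tent δ t * Real.cos (ω * t) := by
    have h := intervalIntegral.integral_comp_neg (a := 0) (b := 1 / 2)
      fun t => tent δ t * Real.cos (ω * t)
    simp only [tent, abs_neg, mul_neg, Real.cos_neg, neg_zero] at h
    rw [neg_div]
    exact h.symm
  rw [integral_Icc_eq_integral_Ioc, ← intervalIntegral.integral_of_le (by norm_num),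
    ← intervalIntegral.integral_add_adjacent_intervals (hi (-1 / 2) 0) (hi 0 (1 / 2)), hleft,
    hright]
  ring

theorem memLp_tent {lam : ℝ} (hlam : -1 < lam) {δ : ℝ} (hδ : 0 < δ) :
    MemLp (fun t => (tent δ t : ℂ)) 2 (weightMeasure lam) := by
  have := isFiniteMeasure_weightMeasure hlam
  have hc : Continuous fun t => (tent δ t : ℂ) :=
    Complex.continuous_ofReal.comp (continuous_tent δ)
  refine MemLp.of_bound hc.aestronglyMeasurable 1 (Eventually.of_forall fun t => ?_)
  rw [Complex.norm_real, Real.norm_of_nonneg (tent_nonneg δ t)]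
  exact tent_le_one hδ t

theorem integrableOn_tent_mul (δ : ℝ) (n : ℤ) :
    IntegrableOn (fun t => (tent δ t : ℂ) * (starRingEnd ℂ) (tau n t))
      (Set.Icc (-1 / 2 : ℝ) (1 / 2)) volume := by
  have h1 : Continuous fun t => (tent δ t : ℂ) :=
    Complex.continuous_ofReal.comp (continuous_tent δ)
  have h2 : Continuous fun t => (starRingEnd ℂ) (tau n t) :=
    Complex.continuous_conj.comp (continuous_tau n)
  exact (h1.mul h2).integrableOn_Icc

theorem re_tau (n : ℤ) (t : ℝ) : (tau n t).re = Real.cos (2 * Real.pi * n * t) := by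
  have h : (2 * Real.pi * Complex.I * n * t : ℂ)
      = ((2 * Real.pi * n * t : ℝ) : ℂ) * Complex.I := by
    push_cast; ring
  rw [tau, h, Complex.exp_ofReal_mul_I_re]

theorem re_fourierCoeffs_tent {δ : ℝ} (hδ : 0 < δ) (hδ' : δ ≤ 1 / 2) {n : ℤ} (hn : n ≠ 0) :
    (fourierCoeffs (fun t => (tent δ t : ℂ)) n).re =
      2 * (1 - Real.cos (2 * Real.pi * n * δ)) / ((2 * Real.pi * n) ^ 2 * δ) := by
  have hω : 2 * Real.pi * (n : ℝ) ≠ 0 :=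
    mul_ne_zero Real.two_pi_pos.ne' (by exact_mod_cast hn)
  rw [fourierCoeffs_eq, ← integral_tent_mul_cos hδ hδ' hω, ← Complex.reCLM_apply,
    ← ContinuousLinearMap.integral_comp_comm _ (integrableOn_tent_mul δ n)]
  refine integral_congr_ae (Eventually.of_forall fun t => ?_)
  simp only [Complex.reCLM_apply, Complex.re_ofReal_mul, Complex.conj_re, re_tau]

theorem fourierCoeffs_congr_ae {lam : ℝ} {f g : ℝ → ℂ} (h : f =ᵐ[weightMeasure lam] g) (n : ℤ) :
    fourierCoeffs f n = fourierCoeffs g n := by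
  refine integral_congr_ae ?_
  filter_upwards [(absolutelyContinuous_weightMeasure lam).ae_le h] with t ht
  rw [ht]

theorem fourierCoeffs_sum_tent {ι : Type*} (F : Finset ι) (c δ : ι → ℝ) (n : ℤ) :
    fourierCoeffs (fun t => ∑ i ∈ F, (c i : ℂ) * (tent (δ i) t : ℂ)) n =
      ∑ i ∈ F, (c i : ℂ) * fourierCoeffs (fun t => (tent (δ i) t : ℂ)) n := by
  simp_rw [fourierCoeffs_eq, Finset.sum_mul, mul_assoc]
  rw [integral_finsetSum _ fun i _ => (integrableOn_tent_mul (δ i) n).const_mul _]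
  simp_rw [integral_const_mul]

/-- The product is at most `1` and lives on `[-δ₂, δ₂]`, where the weight is at most `δ₂^α`. With
`δ₂` the smaller width this gives the near-orthogonality of distant scales. -/
theorem enorm_inner_tent_le {α : ℝ} (hα₀ : 0 < α) {δ₁ δ₂ : ℝ} (h₁ : 0 < δ₁)
    (h₂ : 0 < δ₂) (hα : -1 < α) :
    ‖inner ℂ ((memLp_tent hα h₁).toLp _) ((memLp_tent hα h₂).toLp _)‖ₑ ≤
      2 * ENNReal.ofReal δ₂ ^ (1 + α) := by
  rw [L2.inner_def]
  refine (enorm_integral_le_lintegral_enorm _).trans ?_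
  have hae : ∀ᵐ t ∂(weightMeasure α), ‖inner ℂ (((memLp_tent hα h₁).toLp _ : H α) t)
      (((memLp_tent hα h₂).toLp _ : H α) t)‖ₑ ≤ (Set.Icc (-δ₂) δ₂).indicator 1 t := by
    filter_upwards [(memLp_tent hα h₁).coeFn_toLp, (memLp_tent hα h₂).coeFn_toLp] with t h3 h4
    rw [h3, h4, RCLike.inner_apply, Complex.conj_ofReal, ← Complex.ofReal_mul, ← ofReal_norm,
      Complex.norm_real, Real.norm_of_nonneg (mul_nonneg (tent_nonneg _ _) (tent_nonneg _ _))]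
    by_cases ht : t ∈ Set.Icc (-δ₂) δ₂
    · rw [Set.indicator_of_mem ht, Pi.one_apply, ← ENNReal.ofReal_one]
      exact ENNReal.ofReal_le_ofReal
        (mul_le_one₀ (tent_le_one h₂ t) (tent_nonneg _ _) (tent_le_one h₁ t))
    · rw [Set.indicator_of_notMem ht, tent_eq_zero h₂, zero_mul, ENNReal.ofReal_zero]
      rw [Set.mem_Icc, ← abs_le, not_le] at ht
      exact ht.le
  refine (lintegral_mono_ae hae).trans ?_
  rw [lintegral_indicator_one measurableSet_Icc, weightMeasure,
    withDensity_apply _ measurableSet_Icc]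
  calc _ ≤ ∫⁻ t in Set.Icc (-δ₂) δ₂, weight α t :=
        lintegral_mono' (Measure.restrict_mono le_rfl Measure.restrict_le_self) le_rfl
    _ ≤ ∫⁻ _t in Set.Icc (-δ₂) δ₂, ENNReal.ofReal δ₂ ^ α := by
        refine setLIntegral_mono' measurableSet_Icc fun t ht => ?_
        rw [weight]
        gcongr
        exact abs_le.2 ht
    _ = _ := by
        rw [setLIntegral_const, Real.volume_Icc, sub_neg_eq_add, ← two_mul,
          ENNReal.ofReal_mul (by norm_num), ENNReal.ofReal_ofNat,
          ENNReal.rpow_add _ _ (by simpa using h₂) ENNReal.ofReal_ne_top, ENNReal.rpow_one]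
        ring

/-- Test functions in `H_α` with large Fourier coefficients: up to logarithmic factors they are
extremal for the embedding into `ℓ_{r,2}`, `r = 2 / (1 - α)`. -/
theorem exists_testFunction {α : ℝ} (hα₀ : 0 < α) (hα₁ : α < 1) :
    ∃ K c : ℝ, 0 < K ∧ 0 < c ∧ ∀ N : ℕ, ∃ f : H α, ‖f‖ ^ 2 ≤ K * (N + 1) ∧
      ∀ n : ℕ, 1 ≤ n → n ≤ 2 ^ N →
        c * (n : ℝ) ^ (-((1 - α) / 2)) ≤ (fourierCoeffs f n).re := by
  have hα : -1 < α := by linarith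
  set h : ℝ := (1 + α) / 2 with hh
  have hh0 : 0 < h := by rw [hh]; linarith
  set δ : ℕ → ℝ := fun i => ((2 : ℝ) ^ (i + 1))⁻¹ with hδ
  have hδ0 (i : ℕ) : 0 < δ i := by positivity
  have hδ1 (i : ℕ) : δ i ≤ 1 / 2 := by
    rw [one_div]
    refine inv_anti₀ (by norm_num) ?_
    rw [pow_succ]
    have : (1 : ℝ) ≤ 2 ^ i := one_le_pow₀ (by norm_num)
    linarith
  -- `C i = δ_i^(-(1+α)/2)` normalises the tents: their squared norms in `H α` are `O(δ_i^(1+α))`,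
  -- and scales `k` apart then have inner product at most `2 · 2^(-kh)`.
  set C : ℕ → ℝ := fun i => ((2 : ℝ) ^ (i + 1)) ^ h with hC
  have hC0 (i : ℕ) : 0 < C i := by positivity
  set θ : ℕ → ℝ≥0∞ := fun k => ((2 : ℝ≥0∞) ^ k) ^ (-h) with hθ
  have hθt : ∑' k, θ k ≠ ∞ := tsum_two_pow_rpow_neg_ne_top hh0
  -- The `8` is `4 * A` with `A = 2` in `tsum_tsum_le_of_offDiag`; the `+ 1` keeps `K` positive. The
  -- `4` in the second constant comes from `2 * 2^i ≤ 4n` for the scale `i` selected below.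
  refine ⟨8 * (∑' k, θ k).toReal + 1, 2 / Real.pi ^ 2 * (4 : ℝ) ^ (-((1 - α) / 2)),
    by positivity, by positivity, fun N => ?_⟩
  set f : H α := ∑ i ∈ Finset.range (N + 1), (C i : ℂ) • (memLp_tent hα (hδ0 i)).toLp _ with hf
  refine ⟨f, ?_, fun n hn1 hn2 => ?_⟩
  · set F : ℕ → ℕ → ℝ≥0∞ := fun μ ν => (if μ ∈ Finset.range (N + 1) then 1 else 0) *
      (if ν ∈ Finset.range (N + 1) then 1 else 0) * (‖(C μ : ℂ)‖ₑ * ‖(C ν : ℂ)‖ₑ *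
        ‖inner ℂ ((memLp_tent hα (hδ0 μ)).toLp _) ((memLp_tent hα (hδ0 ν)).toLp _)‖ₑ) with hF
    have hsymm (μ ν : ℕ) : F μ ν = F ν μ := by
      simp only [hF]
      rw [← inner_conj_symm, ← ofReal_norm ((starRingEnd ℂ) _), RCLike.norm_conj, ofReal_norm]
      ring
    have hCe (i : ℕ) : ‖(C i : ℂ)‖ₑ = ((2 : ℝ≥0∞) ^ (i + 1)) ^ h := by
      rw [← ofReal_norm, Complex.norm_real, Real.norm_of_nonneg (hC0 i).le, hC,
        ← ENNReal.ofReal_rpow_of_pos (by positivity), ENNReal.ofReal_pow (by norm_num),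
        ENNReal.ofReal_ofNat]
    have hδe (i : ℕ) : ENNReal.ofReal (δ i) ^ (1 + α) =
        ((2 : ℝ≥0∞) ^ (i + 1)) ^ (-h) * ((2 : ℝ≥0∞) ^ (i + 1)) ^ (-h) := by
      rw [hδ, ENNReal.ofReal_inv_of_pos (by positivity), ENNReal.ofReal_pow (by norm_num),
        ENNReal.ofReal_ofNat, ENNReal.inv_rpow, ← ENNReal.rpow_neg,
        ← ENNReal.rpow_add _ _ (by simp) (by finiteness)]
      congr 1; rw [hh]; ring
    have hoff (μ k : ℕ) : F μ (μ + k) ≤ 2 * ((if μ ∈ Finset.range (N + 1) then 1 else 0) *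
        (if μ + k ∈ Finset.range (N + 1) then 1 else 0) * θ k) := by
      have hin := enorm_inner_tent_le hα₀ (hδ0 μ) (hδ0 (μ + k)) hα
      rw [hδe] at hin
      have hprod : ‖(C μ : ℂ)‖ₑ * ‖(C (μ + k) : ℂ)‖ₑ *
          ‖inner ℂ ((memLp_tent hα (hδ0 μ)).toLp _) ((memLp_tent hα (hδ0 (μ + k))).toLp _)‖ₑ ≤
          2 * θ k := by
        refine (mul_le_mul' le_rfl hin).trans (le_of_eq ?_)
        rw [hCe, hCe, show μ + k + 1 = (μ + 1) + k by ring, pow_add (2 : ℝ≥0∞) (μ + 1) k]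
        have hM : (2 : ℝ≥0∞) ^ (μ + 1) ≠ 0 := by simp
        have hM' : (2 : ℝ≥0∞) ^ (μ + 1) ≠ ∞ := by finiteness
        have hK : (2 : ℝ≥0∞) ^ k ≠ 0 := by simp
        have hK' : (2 : ℝ≥0∞) ^ k ≠ ∞ := by finiteness
        simp only [hθ]
        generalize (2 : ℝ≥0∞) ^ (μ + 1) = M at *
        generalize (2 : ℝ≥0∞) ^ k = L at *
        rw [ENNReal.mul_rpow_of_ne_top hM' hK', ENNReal.mul_rpow_of_ne_top hM' hK']
        have e1 : M ^ h * M ^ (-h) = 1 := by rw [← ENNReal.rpow_add _ _ hM hM']; simp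
        have e2 : L ^ h * L ^ (-h) = 1 := by rw [← ENNReal.rpow_add _ _ hK hK']; simp
        calc _ = 2 * (M ^ h * M ^ (-h)) * (M ^ h * M ^ (-h)) * (L ^ h * L ^ (-h)) * L ^ (-h) := by
              ring
          _ = _ := by rw [e1, e2]; ring
      calc F μ (μ + k) ≤ (if μ ∈ Finset.range (N + 1) then 1 else 0) *
            (if μ + k ∈ Finset.range (N + 1) then 1 else 0) * (2 * θ k) :=
            mul_le_mul' le_rfl hprod
        _ = _ := by ring
    have hmain := tsum_tsum_le_of_offDiag hsymm 2
      (fun μ => if μ ∈ Finset.range (N + 1) then 1 else 0) θ hoff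
    have hcount : ∑' μ : ℕ, (if μ ∈ Finset.range (N + 1) then (1 : ℝ≥0∞) else 0) ^ 2 = N + 1 := by
      rw [tsum_eq_sum (s := Finset.range (N + 1))]
      · rw [Finset.sum_congr rfl (g := fun _ => 1) fun μ hμ => by rw [if_pos hμ, one_pow]]
        simp
      · intro μ hμ; rw [if_neg hμ]; simp
    have hle : ‖f‖ₑ ^ 2 ≤ ENNReal.ofReal (8 * (∑' k, θ k).toReal * (N + 1)) := by
      calc ‖f‖ₑ ^ 2 ≤ _ := enorm_sum_smul_sq_le _ _ _
        _ = ∑ μ ∈ Finset.range (N + 1), ∑ ν ∈ Finset.range (N + 1), F μ ν := by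
            refine Finset.sum_congr rfl fun μ hμ => Finset.sum_congr rfl fun ν hν => ?_
            simp only [hF, if_pos hμ, if_pos hν, one_mul]
        _ ≤ ∑' μ, ∑' ν, F μ ν :=
            (Finset.sum_le_sum fun μ _ => ENNReal.sum_le_tsum _).trans (ENNReal.sum_le_tsum _)
        _ ≤ _ := hmain
        _ = _ := by
            rw [hcount, ENNReal.ofReal_mul (by positivity), ENNReal.ofReal_mul (by positivity),
              ENNReal.ofReal_toReal hθt, ENNReal.ofReal_add (by positivity) (by norm_num)]
            simp only [ENNReal.ofReal_ofNat, ENNReal.ofReal_natCast, ENNReal.ofReal_one]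
            norm_num
    have hle' := ENNReal.toReal_mono ENNReal.ofReal_ne_top hle
    rw [ENNReal.toReal_ofReal (by positivity), ENNReal.toReal_pow, toReal_enorm] at hle'
    have hN : (0 : ℝ) ≤ N := Nat.cast_nonneg N
    linarith
  · have hne : ((n : ℕ) : ℤ) ≠ 0 := by exact_mod_cast (by omega : n ≠ 0)
    have hn0 : (1 : ℝ) ≤ n := by exact_mod_cast hn1
    have hcoef : (fourierCoeffs f n).re = ∑ i ∈ Finset.range (N + 1),
        C i * (2 * (1 - Real.cos (2 * Real.pi * n * δ i)) / ((2 * Real.pi * n) ^ 2 * δ i)) := by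
      rw [fourierCoeffs_congr_ae (sum_smul_toLp_ae (Finset.range (N + 1)) (fun i => (C i : ℂ))
        fun i => memLp_tent hα (hδ0 i)), fourierCoeffs_sum_tent, Complex.re_sum]
      refine Finset.sum_congr rfl fun i _ => ?_
      rw [Complex.re_ofReal_mul, re_fourierCoeffs_tent (hδ0 i) (hδ1 i) hne]
      push_cast
      rfl
    rw [hcoef]
    -- By nonnegativity one scale is enough. This one has `1/2 ≤ n/2^i ≤ 1`, so `2πnδ_i ∈ [π/2, π]`,
    -- the cosine is nonpositive, and the coefficient of the tent is at least `(2/π²) δ_i`.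
    set i := Nat.clog 2 n with hi
    have hi1 : n ≤ 2 ^ i := Nat.le_pow_clog (by norm_num) n
    have hi2 : 2 ^ i ≤ 2 * n := by
      rcases Nat.eq_zero_or_pos i with h0 | h0
      · rw [h0]; omega
      · have h1 := Nat.pow_pred_clog_lt_self (b := 2) (by norm_num) (x := n) (by
          by_contra h2
          have : n = 1 := by omega
          rw [hi, this] at h0
          simp at h0)
        rw [← hi] at h1
        obtain ⟨j, hj⟩ : ∃ j, i = j + 1 := ⟨i - 1, by omega⟩
        rw [hj] at h1 ⊢
        simp only [Nat.pred_eq_sub_one, Nat.add_sub_cancel] at h1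
        rw [pow_succ]; omega
    have hiN : i ∈ Finset.range (N + 1) := by
      rw [Finset.mem_range, Nat.lt_succ_iff]
      exact Nat.clog_le_of_le_pow hn2
    have hpos : ∀ j ∈ Finset.range (N + 1), 0 ≤ C j *
        (2 * (1 - Real.cos (2 * Real.pi * n * δ j)) / ((2 * Real.pi * n) ^ 2 * δ j)) := by
      intro j _
      have := hC0 j
      have := hδ0 j
      have : 0 ≤ 1 - Real.cos (2 * Real.pi * n * δ j) := by linarith [Real.cos_le_one (2 * Real.pi * n * δ j)]
      positivity
    refine le_trans ?_ (Finset.single_le_sum hpos hiN)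
    have hi1' : (n : ℝ) ≤ 2 ^ i := by exact_mod_cast hi1
    have hi2' : (2 : ℝ) ^ i ≤ 2 * n := by exact_mod_cast hi2
    have hδi : δ i = (2 * 2 ^ i)⁻¹ := by simp only [hδ]; rw [pow_succ, mul_comm]
    have hπ := Real.pi_pos
    have h2i : (0 : ℝ) < 2 ^ i := by positivity
    have harg : 2 * Real.pi * n * δ i = Real.pi * (n / 2 ^ i) := by rw [hδi]; field_simp
    have hx1 : (n : ℝ) / 2 ^ i ≤ 1 := (div_le_one h2i).2 hi1'
    have hx2 : 1 / 2 ≤ (n : ℝ) / 2 ^ i := by rw [le_div_iff₀ h2i]; linarith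
    have hcos : Real.cos (2 * Real.pi * n * δ i) ≤ 0 := by
      refine Real.cos_nonpos_of_pi_div_two_le_of_le ?_ ?_
      · rw [harg]; nlinarith
      · rw [harg]; nlinarith
    have hden : (2 * Real.pi * n) ^ 2 * δ i ≤ Real.pi ^ 2 / δ i := by
      rw [le_div_iff₀ (hδ0 i)]
      calc (2 * Real.pi * n) ^ 2 * δ i * δ i = (2 * Real.pi * n * δ i) ^ 2 := by ring
        _ ≤ Real.pi ^ 2 := by
          rw [harg]
          refine pow_le_pow_left₀ (by positivity) ?_ 2
          nlinarith
    have hδp := hδ0 i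
    have hγ : 2 / Real.pi ^ 2 * δ i ≤
        2 * (1 - Real.cos (2 * Real.pi * n * δ i)) / ((2 * Real.pi * n) ^ 2 * δ i) := by
      calc 2 / Real.pi ^ 2 * δ i = 2 / (Real.pi ^ 2 / δ i) := by field_simp
        _ ≤ 2 * (1 - Real.cos (2 * Real.pi * n * δ i)) / ((2 * Real.pi * n) ^ 2 * δ i) := by
          refine div_le_div₀ (by linarith) (by linarith) (by positivity) hden
    have hCδ : C i * δ i = (2 * 2 ^ i : ℝ) ^ (-((1 - α) / 2)) := by
      rw [hδi]
      simp only [hC]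
      rw [pow_succ, mul_comm ((2 : ℝ) ^ i) 2, ← Real.rpow_neg_one (2 * 2 ^ i),
        ← Real.rpow_add (by positivity)]
      congr 1; rw [hh]; ring
    calc 2 / Real.pi ^ 2 * (4 : ℝ) ^ (-((1 - α) / 2)) * (n : ℝ) ^ (-((1 - α) / 2))
        = 2 / Real.pi ^ 2 * (4 * (n : ℝ)) ^ (-((1 - α) / 2)) := by
          rw [Real.mul_rpow (by norm_num) (by positivity), mul_assoc]
      _ ≤ 2 / Real.pi ^ 2 * (2 * 2 ^ i : ℝ) ^ (-((1 - α) / 2)) := by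
          refine mul_le_mul_of_nonneg_left ?_ (by positivity)
          exact Real.rpow_le_rpow_of_nonpos (by positivity) (by linarith) (by linarith)
      _ = C i * (2 / Real.pi ^ 2 * δ i) := by rw [← hCδ]; ring
      _ ≤ _ := mul_le_mul_of_nonneg_left hγ (hC0 i).le

end Tent

/-! ### Failure of boundedness beyond `s = 2` -/

section Sharpness

theorem exists_mul_rpow_lt_mul_rpow {A B e₁ e₂ : ℝ} (hA : 0 < A) (he : e₂ < e₁) :
    ∃ N : ℕ, 1 ≤ N ∧ B * (N : ℝ) ^ e₂ < A * (N : ℝ) ^ e₁ := by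
  have h := ((tendsto_rpow_atTop (sub_pos.2 he)).comp tendsto_natCast_atTop_atTop).eventually_gt_atTop
    (B / A)
  obtain ⟨N, hN, hN1⟩ := (h.and (eventually_ge_atTop 1)).exists
  refine ⟨N, hN1, ?_⟩
  have hN0 : (0 : ℝ) < N := by exact_mod_cast hN1
  simp only [Function.comp_apply] at hN
  rw [div_lt_iff₀ hA, Real.rpow_sub hN0, div_mul_eq_mul_div,
    lt_div_iff₀ (Real.rpow_pos_of_pos hN0 _)] at hN
  linarith

theorem sum_inv_le (N : ℕ) :
    ∑ k ∈ Finset.range (2 ^ N), ((k : ℝ) + 1)⁻¹ ≤ N + 1 := by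
  have h := harmonic_le_one_add_log (2 ^ N)
  have hl : Real.log 2 ≤ 1 := by linarith [Real.log_two_lt_d9]
  have hN : (0 : ℝ) ≤ N := Nat.cast_nonneg N
  simp only [harmonic] at h
  push_cast at h
  rw [Real.log_pow] at h
  nlinarith

theorem le_sum_inv (N : ℕ) :
    (N : ℝ) / 2 ≤ ∑ k ∈ Finset.range (2 ^ N), ((k : ℝ) + 1)⁻¹ := by
  have h := log_add_one_le_harmonic (2 ^ N)
  have hl : 1 / 2 ≤ Real.log 2 := by linarith [Real.log_two_gt_d9]
  have hN : (0 : ℝ) ≤ N := Nat.cast_nonneg N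
  have h2 : Real.log ((2 : ℝ) ^ N) ≤ Real.log (2 ^ N + 1) :=
    Real.log_le_log (by positivity) (by linarith)
  simp only [harmonic] at h
  push_cast at h
  rw [Real.log_pow] at h2
  nlinarith

/-- The finite sequence `n ^ (-e)`, `1 ≤ n ≤ M`. -/
noncomputable def powerSeq (e : ℝ) (M : ℕ) (n : ℤ) : ℂ :=
  if n ∈ Finset.Icc (1 : ℤ) M then (((n : ℝ) ^ (-e) : ℝ) : ℂ) else 0

/-- The indices `1, …, k + 1` all carry modulus at least the value at `k + 1`, since the power
decreases. -/
theorem le_rearr_of_power_le {a : ℤ → ℂ} {c e : ℝ} (hc : 0 ≤ c) (he : 0 ≤ e) {M : ℕ}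
    (h : ∀ n : ℕ, 1 ≤ n → n ≤ M → c * (n : ℝ) ^ (-e) ≤ ‖a n‖) {k : ℕ} (hk : k < M) :
    ENNReal.ofReal (c * ((k : ℝ) + 1) ^ (-e)) ≤ rearr a k := by
  refine le_rearr_of_forall_mem (Finset.Icc (1 : ℤ) (k + 1)) (by simp) fun z hz => ?_
  rw [Finset.mem_Icc] at hz
  obtain ⟨n, rfl⟩ := Int.eq_ofNat_of_zero_le (by omega : 0 ≤ z)
  rw [← ofReal_norm]
  refine ENNReal.ofReal_le_ofReal (le_trans ?_ (h n (by omega) (by omega)))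
  refine mul_le_mul_of_nonneg_left ?_ hc
  refine Real.rpow_le_rpow_of_nonpos (by exact_mod_cast (by omega : 0 < n)) ?_ (by linarith)
  exact_mod_cast (by omega : n ≤ k + 1)

theorem rearr_powerSeq_le {e : ℝ} (he : 0 ≤ e) (M k : ℕ) :
    rearr (powerSeq e M) k ≤ if k < M then ((k : ℝ≥0∞) + 1) ^ (-e) else 0 := by
  refine rearr_le_of_encard_le ?_
  have hcard : (↑(Finset.Icc (1 : ℤ) k) : Set ℤ).encard ≤ k := by
    rw [Set.encard_coe_eq_coe_finsetCard]
    simp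
  refine le_trans (Set.encard_le_encard fun z hz => ?_) hcard
  simp only [Set.mem_ofPred_eq, powerSeq] at hz
  rw [Finset.mem_coe, Finset.mem_Icc]
  split_ifs at hz with h1 h2 h2
  · rw [Finset.mem_Icc] at h2
    refine ⟨h2.1, ?_⟩
    by_contra! hlt
    have hz0 : (0 : ℝ) < z := by exact_mod_cast (by omega : 0 < z)
    refine absurd hz (not_lt.2 ?_)
    rw [natCast_add_one_rpow_eq_ofReal, ← ofReal_norm, Complex.norm_real,
      Real.norm_of_nonneg (Real.rpow_nonneg hz0.le _)]
    refine ENNReal.ofReal_le_ofReal (Real.rpow_le_rpow_of_nonpos (by positivity) ?_ (by linarith))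
    exact_mod_cast (by omega : (k : ℤ) + 1 ≤ z)
  · simp at hz
  · rw [Finset.mem_Icc] at h2
    omega
  · simp at hz

/-- With exponent `1/p` the `n`-th term of the defining sum is at most `1/n`, so the sum is harmonic
of length `2^N`. -/
theorem lorentzNorm_powerSeq_rpow_le {p : ℝ} (hp : 0 < p) {s : ℝ≥0∞} (hs : 0 < s) (hs' : s ≠ ∞)
    (N : ℕ) :
    lorentzNorm p s (powerSeq (1 / p) (2 ^ N)) ^ s.toReal ≤ ENNReal.ofReal (N + 1) := by
  have hσ : 0 < s.toReal := ENNReal.toReal_pos hs.ne' hs'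
  have hterm (k : ℕ) : (((k : ℝ≥0∞) + 1) ^ (1 / p) * rearr (powerSeq (1 / p) (2 ^ N)) k) ^ s.toReal /
      ((k : ℝ≥0∞) + 1) ≤ if k ∈ Finset.range (2 ^ N) then ENNReal.ofReal (((k : ℝ) + 1)⁻¹) else 0 := by
    have h := rearr_powerSeq_le (e := 1 / p) (by positivity) (2 ^ N) k
    simp only [Finset.mem_range]
    split_ifs at h ⊢ with hk
    · have h1 : ((k : ℝ≥0∞) + 1) ^ (1 / p) * rearr (powerSeq (1 / p) (2 ^ N)) k ≤ 1 := by
        refine (mul_le_mul' le_rfl h).trans (le_of_eq ?_)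
        rw [← ENNReal.rpow_add _ _ (natCast_add_one_ne_zero k) (natCast_add_one_ne_top k)]
        simp
      calc _ ≤ (1 : ℝ≥0∞) ^ s.toReal / ((k : ℝ≥0∞) + 1) := by gcongr
        _ = _ := by
          rw [ENNReal.one_rpow, one_div, ← ENNReal.rpow_neg_one, natCast_add_one_rpow_eq_ofReal,
            Real.rpow_neg_one]
    · rw [nonpos_iff_eq_zero.1 h, mul_zero, ENNReal.zero_rpow_of_pos hσ, ENNReal.zero_div]
  rw [lorentzNorm_rpow hs hs']
  refine (ENNReal.tsum_le_tsum hterm).trans ?_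
  rw [tsum_eq_sum (s := Finset.range (2 ^ N)) fun k hk => if_neg hk,
    Finset.sum_congr rfl fun k hk => if_pos hk,
    ← ENNReal.ofReal_sum_of_nonneg fun k _ => by positivity]
  exact ENNReal.ofReal_le_ofReal (sum_inv_le N)

theorem le_lorentzNorm_rpow {p : ℝ} (hp : 0 < p) {s : ℝ≥0∞} (hs : 0 < s) (hs' : s ≠ ∞) {c : ℝ}
    (hc : 0 ≤ c) {a : ℤ → ℂ} {N : ℕ}
    (h : ∀ n : ℕ, 1 ≤ n → n ≤ 2 ^ N → c * (n : ℝ) ^ (-(1 / p)) ≤ ‖a n‖) :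
    ENNReal.ofReal (c ^ s.toReal * (N / 2)) ≤ lorentzNorm p s a ^ s.toReal := by
  have hσ : 0 < s.toReal := ENNReal.toReal_pos hs.ne' hs'
  rw [lorentzNorm_rpow hs hs']
  refine le_trans ?_ (ENNReal.sum_le_tsum (Finset.range (2 ^ N)))
  calc _ ≤ ENNReal.ofReal (c ^ s.toReal * ∑ k ∈ Finset.range (2 ^ N), ((k : ℝ) + 1)⁻¹) := by
        refine ENNReal.ofReal_le_ofReal ?_
        gcongr
        exact le_sum_inv N
    _ = ∑ k ∈ Finset.range (2 ^ N), ENNReal.ofReal (c ^ s.toReal * ((k : ℝ) + 1)⁻¹) := by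
        rw [Finset.mul_sum, ENNReal.ofReal_sum_of_nonneg fun k _ => by positivity]
    _ ≤ _ := by
        refine Finset.sum_le_sum fun k hk => ?_
        have h1 := le_rearr_of_power_le hc (by positivity) h (Finset.mem_range.1 hk)
        have h2 : ENNReal.ofReal c ≤ ((k : ℝ≥0∞) + 1) ^ (1 / p) * rearr a k := by
          refine le_trans (le_of_eq ?_) (mul_le_mul' le_rfl h1)
          rw [ENNReal.ofReal_mul hc, ← natCast_add_one_rpow_eq_ofReal, mul_left_comm,
            ← ENNReal.rpow_add _ _ (natCast_add_one_ne_zero k) (natCast_add_one_ne_top k)]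
          simp
        rw [ENNReal.ofReal_mul (by positivity), ← ENNReal.ofReal_rpow_of_nonneg hc hσ.le,
          ← Real.rpow_neg_one, ← natCast_add_one_rpow_eq_ofReal, ENNReal.rpow_neg_one,
          ← div_eq_mul_inv]
        gcongr

/-- On the test functions boundedness would give `N ≲ ‖f‖^s ≲ N^(s/2)`, impossible for large `N`
when `s < 2`. -/
theorem not_coeffTransformBounded {α : ℝ} (hα₀ : 0 < α) (hα₁ : α < 1) {s : ℝ≥0∞} (hs : 0 < s)
    (hs2 : s < 2) : ¬ CoeffTransformBounded α (2 / (1 - α)) s := by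
  rintro ⟨-, -, C, hC⟩
  obtain ⟨K, c, hK, hc, hf⟩ := exists_testFunction hα₀ hα₁
  have hs' : s ≠ ∞ := (hs2.trans (by simp)).ne
  have hσ : 0 < s.toReal := ENNReal.toReal_pos hs.ne' hs'
  have hσ2 : s.toReal < 2 := by
    have := (ENNReal.toReal_lt_toReal hs' (by simp)).2 hs2
    simpa using this
  set σ := s.toReal with hσdef
  have h1α : 0 < 1 - α := by linarith
  have hp : 0 < 2 / (1 - α) := by positivity
  have hpe : 1 / (2 / (1 - α)) = (1 - α) / 2 := by rw [one_div_div]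
  obtain ⟨N, hN1, hN⟩ := exists_mul_rpow_lt_mul_rpow (A := (c ^ σ * 2⁻¹) ^ (2 / σ))
    (B := (C : ℝ) ^ 2 * (2 * K)) (e₁ := 2 / σ) (e₂ := 1) (by positivity)
    (by rwa [lt_div_iff₀ hσ, one_mul])
  obtain ⟨f, hfn, hfc⟩ := hf N
  have h1 := le_lorentzNorm_rpow hp hs hs' hc.le (a := fourierCoeffs f) (N := N)
    fun n hn1 hn2 => by
      rw [hpe]
      exact (hfc n hn1 hn2).trans (Complex.re_le_norm _)
  have hCf : (C : ℝ≥0∞) * ‖f‖ₑ = ENNReal.ofReal (C * ‖f‖) := by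
    rw [ENNReal.ofReal_mul C.coe_nonneg, ofReal_norm, ENNReal.ofReal_coe_nnreal]
  have h2 : ENNReal.ofReal (c ^ σ * (N / 2)) ≤ ENNReal.ofReal ((C * ‖f‖) ^ σ) := by
    refine h1.trans ?_
    rw [← ENNReal.ofReal_rpow_of_nonneg (by positivity) hσ.le, ← hCf]
    gcongr
    exact hC f
  rw [ENNReal.ofReal_le_ofReal_iff (by positivity)] at h2
  have h3 : (c ^ σ * (N / 2)) ^ (2 / σ) ≤ (C * ‖f‖) ^ 2 := by
    have := Real.rpow_le_rpow (by positivity) h2 (show 0 ≤ 2 / σ by positivity)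
    rwa [← Real.rpow_mul (by positivity), mul_div_cancel₀ _ hσ.ne', Real.rpow_two] at this
  have hN0 : (1 : ℝ) ≤ N := by exact_mod_cast hN1
  have h4 : (C * ‖f‖) ^ 2 ≤ (C : ℝ) ^ 2 * (2 * K) * N := by
    rw [mul_pow, mul_assoc]
    gcongr
    nlinarith
  have h5 : (c ^ σ * (N / 2)) ^ (2 / σ) = (c ^ σ * 2⁻¹) ^ (2 / σ) * (N : ℝ) ^ (2 / σ) := by
    rw [← Real.mul_rpow (by positivity) (by positivity)]
    congr 1; ring
  rw [Real.rpow_one] at hN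
  linarith

/-- The hypothesis speaks only of some limit `g`; for finitely supported `a`, uniqueness of limits
identifies it with the finite sum. -/
theorem enorm_sum_smul_tauH_le_of_bounded {lam : ℝ} {hlam : -1 < lam} {p : ℝ} {s : ℝ≥0∞} {C : ℝ≥0}
    (hC : ∀ a : ℤ → ℂ, MemLorentz p s a → ∃ g : H lam,
      Tendsto (fun N : ℕ => ∑ k ∈ Finset.range N, a (natArr k) • tauH hlam (natArr k))
        atTop (𝓝 g) ∧ ‖g‖ₑ ≤ C * lorentzNorm p s a)
    {a : ℤ → ℂ} (ha : MemLorentz p s a) (F : Finset ℤ) (hF : ∀ n ∉ F, a n = 0) :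
    ‖∑ n ∈ F, a n • tauH hlam n‖ₑ ≤ C * lorentzNorm p s a := by
  obtain ⟨g, hg, hgn⟩ := hC a ha
  have h1 : HasSum (fun n => a n • tauH hlam n) (∑ n ∈ F, a n • tauH hlam n) :=
    hasSum_sum_of_ne_finset_zero fun n hn => by rw [hF n hn, zero_smul]
  have h2 := ((Equiv.ofBijective natArr natArr_bijective).hasSum_iff.2 h1).tendsto_sum_nat
  rwa [tendsto_nhds_unique hg h2] at hgn

/-- The power sequence is paired with the coefficients of the test function: the pairing is `≳ N`,
while duality and boundedness give `≲ N^(1/2) N^(1/s)`, a smaller power when `s > 2`. -/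
theorem not_seriesTransformBounded {α : ℝ} (hα₀ : 0 < α) (hα₁ : α < 1) {s : ℝ≥0∞} (hs2 : 2 < s)
    (hs' : s ≠ ∞) : ¬ SeriesTransformBounded (neg_lt_neg hα₁) (2 / (1 + α)) s := by
  rintro ⟨C, hC⟩
  obtain ⟨K, c, hK, hc, hf⟩ := exists_testFunction hα₀ hα₁
  have hs : 0 < s := lt_trans (by norm_num) hs2
  have hσ2 : 2 < s.toReal := by
    have := (ENNReal.toReal_lt_toReal (by simp) hs').2 hs2
    simpa using this
  set σ := s.toReal with hσdef
  have hσ : 0 < σ := by linarith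
  set p : ℝ := 2 / (1 + α) with hpdef
  have hp : 0 < p := by positivity
  have hpe : 1 / p = (1 + α) / 2 := by rw [hpdef, one_div_div]
  obtain ⟨N, hN1, hN⟩ := exists_mul_rpow_lt_mul_rpow (A := (c / 2) ^ 2)
    (B := 2 * K * ((C : ℝ) * 2 ^ (1 / σ)) ^ 2) (e₁ := 2) (e₂ := 1 + 2 / σ) (by positivity)
    (by have : 2 / σ < 1 := (div_lt_one hσ).2 hσ2
        linarith)
  obtain ⟨f, hfn, hfc⟩ := hf N
  have hN0 : (1 : ℝ) ≤ N := by exact_mod_cast hN1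
  set a := powerSeq (1 / p) (2 ^ N) with ha
  set F := Finset.Icc (1 : ℤ) ((2 ^ N : ℕ) : ℤ) with hF
  have hnorm : lorentzNorm p s a ≤ ENNReal.ofReal ((2 * N : ℝ) ^ (1 / σ)) := by
    have h := ENNReal.rpow_le_rpow (lorentzNorm_powerSeq_rpow_le hp hs hs' N)
      (show 0 ≤ 1 / σ by positivity)
    rw [← ENNReal.rpow_mul, mul_one_div_cancel hσ.ne', ENNReal.rpow_one,
      ENNReal.ofReal_rpow_of_nonneg (by positivity) (by positivity)] at h
    refine h.trans (ENNReal.ofReal_le_ofReal ?_)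
    gcongr
    linarith
  have hmem : MemLorentz p s a := hnorm.trans_lt ENNReal.ofReal_lt_top
  have hg := enorm_sum_smul_tauH_le_of_bounded hC hmem F fun n hn => by
    rw [ha, powerSeq, if_neg hn]
  have hg' : ‖∑ n ∈ F, a n • tauH (neg_lt_neg hα₁) n‖ ≤ C * (2 * N : ℝ) ^ (1 / σ) := by
    have h := hg.trans (mul_le_mul' le_rfl hnorm)
    rw [← ofReal_norm, ← ENNReal.ofReal_coe_nnreal, ← ENNReal.ofReal_mul C.coe_nonneg,
      ENNReal.ofReal_le_ofReal_iff (by positivity)] at h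
    exact h
  have hdual : ‖∑ n ∈ F, (starRingEnd ℂ) (a n) * fourierCoeffs f n‖ ≤
      ‖f‖ * ‖∑ n ∈ F, a n • tauH (neg_lt_neg hα₁) n‖ := by
    have h := enorm_sum_conj_mul_fourierCoeffs_le hα₁ f F a
    rw [← ofReal_norm, ← ofReal_norm, ← ofReal_norm, ← ENNReal.ofReal_mul (norm_nonneg _),
      ENNReal.ofReal_le_ofReal_iff (by positivity)] at h
    exact h
  have hlow : c * (N / 2) ≤ ‖∑ n ∈ F, (starRingEnd ℂ) (a n) * fourierCoeffs f n‖ := by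
    refine le_trans ?_ (Complex.re_le_norm _)
    have himg : F = (Finset.range (2 ^ N)).map
        ⟨fun k : ℕ => (k : ℤ) + 1, fun k l h => by simpa using h⟩ := by
      ext z
      simp only [hF, Finset.mem_Icc, Finset.mem_map, Finset.mem_range]
      change _ ↔ ∃ k : ℕ, k < 2 ^ N ∧ (k : ℤ) + 1 = z
      constructor
      · rintro ⟨h1, h2⟩
        exact ⟨(z - 1).toNat, by omega, by omega⟩
      · rintro ⟨k, hk, rfl⟩
        omega
    rw [Complex.re_sum]
    calc c * (N / 2) ≤ c * ∑ k ∈ Finset.range (2 ^ N), ((k : ℝ) + 1)⁻¹ := by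
          gcongr
          exact le_sum_inv N
      _ = ∑ k ∈ Finset.range (2 ^ N), c * ((k : ℝ) + 1)⁻¹ := Finset.mul_sum _ _ _
      _ ≤ ∑ k ∈ Finset.range (2 ^ N),
          ((starRingEnd ℂ) (a ((k : ℤ) + 1)) * fourierCoeffs f ((k : ℤ) + 1)).re := by
          refine Finset.sum_le_sum fun k hk => ?_
          have hk' := Finset.mem_range.1 hk
          have hmemF : (k : ℤ) + 1 ∈ Finset.Icc (1 : ℤ) ((2 ^ N : ℕ) : ℤ) := by
            rw [Finset.mem_Icc]; omega
          have h := hfc (k + 1) (by omega) (by omega)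
          push_cast at h
          rw [ha, powerSeq, if_pos hmemF, Complex.conj_ofReal, Complex.re_ofReal_mul]
          push_cast
          have hk0 : (0 : ℝ) < (k : ℝ) + 1 := by positivity
          -- The exponents `(1+α)/2` and `(1-α)/2` add up to `1`, so the pairing is a harmonic sum.
          calc c * ((k : ℝ) + 1)⁻¹
              = ((k : ℝ) + 1) ^ (-(1 / p)) * (c * ((k : ℝ) + 1) ^ (-((1 - α) / 2))) := by
                rw [mul_left_comm, ← Real.rpow_add hk0, ← Real.rpow_neg_one, hpe]
                congr 2; ring
            _ ≤ _ := by gcongr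
      _ = _ := by rw [himg, Finset.sum_map]; rfl
  have h1 : c * (N / 2) ≤ ‖f‖ * (C * (2 * N : ℝ) ^ (1 / σ)) :=
    hlow.trans (hdual.trans (mul_le_mul_of_nonneg_left hg' (norm_nonneg _)))
  have h2 : (c * (N / 2)) ^ 2 ≤ (2 * K * N) * (C * (2 * N : ℝ) ^ (1 / σ)) ^ 2 := by
    refine (pow_le_pow_left₀ (by positivity) h1 2).trans ?_
    rw [mul_pow ‖f‖]
    gcongr
    nlinarith
  have hNpos : (0 : ℝ) < N := by linarith
  have h3 : (2 * K * N) * (C * (2 * N : ℝ) ^ (1 / σ)) ^ 2 =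
      2 * K * ((C : ℝ) * 2 ^ (1 / σ)) ^ 2 * (N : ℝ) ^ (1 + 2 / σ) := by
    have h4 : (N : ℝ) ^ (2 / σ) = ((N : ℝ) ^ (1 / σ)) ^ 2 := by
      rw [← Real.rpow_natCast, ← Real.rpow_mul hNpos.le]
      congr 1; push_cast; ring
    rw [Real.rpow_add hNpos, Real.rpow_one, h4, Real.mul_rpow (by norm_num) hNpos.le]
    ring
  rw [h3] at h2
  rw [Real.rpow_two] at hN
  nlinarith

end Sharpness

end PowerFourier

/-! ### Reduction to the critical indices -/

theorem mainTheorem9 (α p : ℝ) (s : ℝ≥0∞) (hα₀ : 0 < α) (hα₁ : α < 1) (hp : 0 < p)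
    (hs : 0 < s) :
    (PowerFourier.CoeffTransformBounded α p s ↔
      (2 / (1 - α) < p ∨ (p = 2 / (1 - α) ∧ 2 ≤ s))) ∧
    (PowerFourier.SeriesTransformBounded (lam := -α) (neg_lt_neg hα₁) p s ↔
      (p < 2 / (1 + α) ∨ (p = 2 / (1 + α) ∧ s ≤ 2))) := by
  have hr : 0 < 2 / (1 - α) := div_pos two_pos (by linarith)
  have hq : 0 < 2 / (1 + α) := div_pos two_pos (by linarith)
  refine ⟨⟨fun h => ?_, fun h => ?_⟩, ⟨fun h => ?_, fun h => ?_⟩⟩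
  · by_contra! hcon
    obtain ⟨h1, h2⟩ := hcon
    rcases h1.lt_or_eq with hlt | rfl
    -- Boundedness at some `p < r` would embed into boundedness at `(r, 1)`, which is excluded
    -- because `1 < 2`.
    · exact PowerFourier.not_coeffTransformBounded hα₀ hα₁ one_pos (by norm_num)
        (h.mono hp hs one_pos (Or.inl hlt))
    · exact PowerFourier.not_coeffTransformBounded hα₀ hα₁ hs (h2 rfl) h
  · refine (PowerFourier.coeffTransformBounded_critical hα₀ hα₁).mono hr (by norm_num) hs ?_
    exact h.imp id fun h => ⟨h.1.symm, h.2⟩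
  · by_contra! hcon
    obtain ⟨h1, h2⟩ := hcon
    rcases h1.lt_or_eq with hlt | rfl
    -- For `p > q` the space `ℓ_{q,3}` embeds into `ℓ_{p,s}`; any finite second index above `2`
    -- would serve.
    · exact PowerFourier.not_seriesTransformBounded hα₀ hα₁ (s := 3) (by norm_num) (by norm_num)
        (h.mono hq (by norm_num) hs (Or.inl hlt))
    -- The counterexample requires a finite second index; `min s 3` covers `s = ∞` as well.
    · have hlt : 2 < min s 3 := lt_min (h2 rfl) (by norm_num)
      refine PowerFourier.not_seriesTransformBounded hα₀ hα₁ hlt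
        (ne_top_of_le_ne_top (by norm_num) (min_le_right s 3))
        (h.mono hp (lt_trans (by norm_num) hlt) hs (Or.inr ⟨rfl, min_le_left _ _⟩))
  · exact (PowerFourier.seriesTransformBounded_critical hα₀ hα₁).mono hp hs (by norm_num) h
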